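/- Work in the ring $\mathbb{Z}[[q]]$ of formal power series (infinite sums and products converge coefficientwise), and write $(a;q)_n=\prod_{k=0}^{n-1}(1-aq^k)$, $(a;q)_\infty=\prod_{k\ge 0}(1-aq^k)$ and $E_j=(q^j;q^j)_\infty$ for $j\ge 1$. Let $\phi$ be Ramanujan's Appell–Lerch sum and $a(n)$ its coefficients: $$\phi(q)=\sum_{n=0}^{\infty}\frac{(-q;q)_{2n}\,q^{n+1}}{(q;q^2)_{n+1}^2}=\sum_{n=1}^{\infty}a(n)q^n .$$ **Theorem.** The generating function of $a(10n+9)$ is $$\sum_{n=0}^{\infty}a(10n+9)q^n=5\left(46\,\frac{E_5E_{10}^2}{E_2^2}+460\,q\,\frac{E_{10}^5}{E_1^3E_2}+1125\,q^2\,\frac{E_{10}^8}{E_1^6E_5}+1875\,q\,\frac{E_2^8E_5^9}{E_1^{16}}+15625\,q^2\,\frac{E_2^8E_5^{15}}{E_1^{22}}\right).$$ In particular, $a(10n+9)\equiv 0\pmod 5$ for every integer $n\ge 0$. -/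

import Mathlib

open PowerSeries
open scoped PowerSeries.WithPiTopology

namespace AppellLerch

/-- The finite `q`-shifted factorial `(a; q)_n = ∏_{k < n} (1 - a q ^ k)`, for formal power series
`a` and `q` with integer coefficients. -/
noncomputable def qPoch (a q : ℤ⟦X⟧) (n : ℕ) : ℤ⟦X⟧ :=
  ∏ k ∈ Finset.range n, (1 - a * q ^ k)

/-- The infinite `q`-shifted factorial `(a; q)_∞ = ∏_{k ≥ 0} (1 - a q ^ k)`. The product is taken in
the topology of coefficientwise convergence on `ℤ⟦X⟧`. -/
noncomputable def qPochInf (a q : ℤ⟦X⟧) : ℤ⟦X⟧ :=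
  ∏' k : ℕ, (1 - a * q ^ k)

/-- The quotient `f / g` of formal power series; it is meaningful when `g` is a unit of `ℤ⟦X⟧`,
as all the denominators below are (`isUnit_E`, `isUnit_qPoch`). -/
noncomputable def quot (f g : ℤ⟦X⟧) : ℤ⟦X⟧ :=
  f * Ring.inverse g

/-- `E_j = (q^j; q^j)_∞`, with `q` the variable `X`. -/
noncomputable def E (j : ℕ) : ℤ⟦X⟧ :=
  qPochInf (X ^ j) (X ^ j)

/-- The `n`-th term `(-q; q)_{2n} q^{n+1} / (q; q^2)_{n+1}^2` of the series `φ(q)`. -/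
noncomputable def phiTerm (n : ℕ) : ℤ⟦X⟧ :=
  quot (qPoch (-X) X (2 * n) * X ^ (n + 1)) (qPoch X (X ^ 2) (n + 1) ^ 2)

/-- Ramanujan's Appell–Lerch sum `φ(q) = ∑_{n ≥ 0} (-q; q)_{2n} q^{n+1} / (q; q^2)_{n+1}^2`. -/
noncomputable def phi : ℤ⟦X⟧ :=
  ∑' n : ℕ, phiTerm n

/-- The coefficients `a(n)` in `φ(q) = ∑ a(n) q^n` (here `a(0) = 0`). -/
noncomputable def a (n : ℕ) : ℤ :=
  coeff n phi

/-- `quot f g` is the quotient of `f` by `g` when `g` is a unit. -/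
theorem quot_mul_cancel (f : ℤ⟦X⟧) {g : ℤ⟦X⟧} (hg : IsUnit g) : quot f g * g = f := by
  rw [quot, mul_assoc, Ring.inverse_mul_cancel _ hg, mul_one]

/-- The product defining `E_j` converges for `j ≥ 1`. -/
theorem multipliable_E {j : ℕ} (hj : 0 < j) :
    Multipliable fun k : ℕ => (1 : ℤ⟦X⟧) - X ^ j * (X ^ j) ^ k := by
  simp_rw [sub_eq_add_neg]
  apply WithPiTopology.multipliable_one_add_of_tendsto_order_atTop_nhds_top
  refine ENat.tendsto_nhds_top_iff_natCast_lt.mpr fun n => Filter.eventually_atTop.mpr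
    ⟨n, fun m hm => ?_⟩
  rw [order_neg, ← pow_succ', ← pow_mul, order_X_pow, Nat.cast_lt]
  nlinarith

theorem isUnit_E {j : ℕ} (hj : 0 < j) : IsUnit (E j) := by
  rw [isUnit_iff_constantCoeff, E, qPochInf,
    (multipliable_E hj).map_tprod _ (WithPiTopology.continuous_constantCoeff ℤ)]
  simp [hj.ne']

theorem isUnit_qPoch (n : ℕ) : IsUnit (qPoch X (X ^ 2) n) := by
  rw [isUnit_iff_constantCoeff, qPoch, map_prod]
  simp

/-- The series defining `φ(q)` converges. -/
theorem summable_phiTerm : Summable phiTerm := by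
  apply WithPiTopology.summable_of_tendsto_order_atTop_nhds_top
  refine ENat.tendsto_nhds_top_iff_natCast_lt.mpr fun n => Filter.eventually_atTop.mpr
    ⟨n, fun m hm => ?_⟩
  have h : ((m + 1 : ℕ) : ℕ∞) ≤ (phiTerm m).order := by
    rw [phiTerm, quot]
    grw [← le_order_mul, ← le_order_mul, order_X_pow]
    exact le_add_right le_add_self
  refine lt_of_lt_of_le ?_ h
  exact_mod_cast Nat.lt_succ_of_le hm

end AppellLerch

/-!
The partial fraction expansion of `(q; q)_{m+n} / ((z; q)_{m+1} (q / z; q)_n)` at `z = q ^ (1 / 2)`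
exhibits `1 / (q; q ^ 2)_{n+1} ^ 2` as one half of a Bailey pair. Inserting it in `φ(q)` and summing
over the other index by a telescoping argument gives `φ(q) f(-q, -q) = L(q)`, where `f(a, b)` is
Ramanujan's theta function and `L(q) = ∑ (-1) ^ r q ^ ((r + 1) ^ 2) / (1 - q ^ (2 r + 1))`. Since
`f(q, q) f(-q, -q) = f(-q ^ 2, -q ^ 2) ^ 2` is even, multiplying by `f(q, q)` and keeping the odd
part isolates the series `∑ a(2 n + 1) q ^ n`; on the other side the odd part of `L(q) f(q, q)`
reduces to bilateral Lerch series, and these are multiples of `ψ(q) ^ 2` by the limiting case of the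
same partial fraction expansion. The outcome is `f(-q, -q) ^ 2 ∑ a(2 n + 1) q ^ n = ψ(q) ^ 3`.

The components modulo `5` of `ψ(q)` and `f(-q, -q)` are theta functions. Multiplying `f(-q, -q)` by
its four conjugates under `q ↦ ζ q`, with `ζ` a primitive fifth root of unity, makes the
denominator a series in `q ^ 5`, so that `∑ a(10 n + 9) q ^ n` is a rational function of these
theta functions. By Ramanujan's parametrisation they are, up to scaling, rational functions of
`k = r(q) r(q ^ 2) ^ 2`, where `r` is the Rogers–Ramanujan continued fraction. The result depends on
`k` only through `T = (1 - k ^ 2) / k`, and the five eta quotients come from the product formulas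
for `T`, `T + 1` and `T - 4`.
-/

namespace AppellLerch

open Filter Topology
open Finset.HasAntidiagonal (antidiagonal)

/-! ### Convergence of families of power series -/

section Convergence

variable {ι κ R : Type*} [CommRing R]

/-- A family of power series *decays* if modulo any power of `X` all but finitely many members
vanish. Such families are summable in the topology of coefficientwise convergence, and unlike
summability this is inherited by products of families. -/
def Decays (f : ι → R⟦X⟧) : Prop :=
  ∀ n : ℕ, {i | ¬ X ^ n ∣ f i}.Finite

namespace Decays

variable {f : ι → R⟦X⟧} {g : κ → R⟦X⟧}

theorem comp_injective (hf : Decays f) {e : κ → ι} (he : Function.Injective e) :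
    Decays (f ∘ e) := fun n => (hf n).preimage he.injOn

theorem of_dvd {g : ι → R⟦X⟧} (hf : Decays f) (h : ∀ i, f i ∣ g i) : Decays g := fun n =>
  (hf n).subset fun i hi hdvd => hi (hdvd.trans (h i))

theorem mul (hf : Decays f) (hg : Decays g) : Decays fun p : ι × κ => f p.1 * g p.2 := fun n =>
  ((hf n).prod (hg n)).subset fun _ hp =>
    ⟨fun h => hp (h.mul_right _), fun h => hp (h.mul_left _)⟩

theorem summable [TopologicalSpace R] (hf : Decays f) : Summable f := by
  rw [WithPiTopology.summable_iff_summable_coeff]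
  intro d
  refine summable_of_hasFiniteSupport ((hf (d + 1)).subset fun i hi hdvd => hi ?_)
  exact X_pow_dvd_iff.mp hdvd d (Nat.lt_succ_self d)

variable [TopologicalSpace R] [IsTopologicalRing R] [T2Space R]

theorem tsum_mul_tsum (hf : Decays f) (hg : Decays g) :
    (∑' i, f i) * ∑' j, g j = ∑' p : ι × κ, f p.1 * g p.2 :=
  hf.summable.tsum_mul_tsum hg.summable (hf.mul hg).summable

theorem tsum_prod {f : ι × κ → R⟦X⟧} (hf : Decays f) :
    ∑' p, f p = ∑' i, ∑' j, f (i, j) :=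
  hf.summable.tsum_prod' fun i => (hf.comp_injective (Prod.mk_right_injective i)).summable

theorem tsum_antidiagonal {f : ℕ × ℕ → R⟦X⟧} (hf : Decays f) :
    ∑' n, ∑ p ∈ antidiagonal n, f p = ∑' p, f p :=
  ((Finset.HasAntidiagonal.sigmaAntidiagonalEquivProd.hasSum_iff.mpr hf.summable.hasSum).sigma
    fun n => (antidiagonal n).hasSum f).tsum_eq

end Decays

theorem decays_X_pow {e : ι → ℕ} (he : ∀ n, {i | e i < n}.Finite) :
    Decays fun i => (X : R⟦X⟧) ^ e i := fun n =>
  (he n).subset fun i hi => by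
    by_contra h
    exact hi (pow_dvd_pow X (not_lt.mp h))

theorem decays_of_X_pow_dvd {f : ℕ → R⟦X⟧} (h : ∀ n, X ^ n ∣ f n) : Decays f :=
  (decays_X_pow (e := fun n : ℕ => n) Set.finite_lt_nat).of_dvd h

theorem eq_of_forall_X_pow_dvd_sub {f g : R⟦X⟧} (h : ∀ n : ℕ, X ^ n ∣ f - g) : f = g := by
  ext n
  have := X_pow_dvd_iff.mp (h (n + 1)) n (Nat.lt_succ_self n)
  rwa [map_sub, sub_eq_zero] at this

variable [TopologicalSpace R]

theorem tendsto_of_eventually_X_pow_dvd {l : Filter ι} {f : ι → R⟦X⟧} {g : R⟦X⟧}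
    (h : ∀ n : ℕ, ∀ᶠ i in l, X ^ n ∣ f i - g) : Tendsto f l (𝓝 g) := by
  rw [WithPiTopology.tendsto_iff_coeff_tendsto]
  intro d
  refine tendsto_const_nhds.congr' ?_
  filter_upwards [h (d + 1)] with i hi
  have := X_pow_dvd_iff.mp hi d (Nat.lt_succ_self d)
  rw [map_sub, sub_eq_zero] at this
  exact this.symm

variable [T2Space R]

theorem X_pow_dvd_of_tendsto {l : Filter ι} [l.NeBot] {f : ι → R⟦X⟧} {g : R⟦X⟧} {n : ℕ}
    (hf : Tendsto f l (𝓝 g)) (h : ∀ᶠ i in l, X ^ n ∣ f i) : X ^ n ∣ g := by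
  rw [X_pow_dvd_iff]
  intro m hm
  refine tendsto_nhds_unique
    (((WithPiTopology.continuous_coeff R m).tendsto g).comp hf) (tendsto_const_nhds.congr' ?_)
  filter_upwards [h] with i hi using (X_pow_dvd_iff.mp hi m hm).symm

theorem X_pow_dvd_tsum {f : ι → R⟦X⟧} {n : ℕ} (h : ∀ i, X ^ n ∣ f i) : X ^ n ∣ ∑' i, f i := by
  by_cases hf : Summable f
  · exact X_pow_dvd_of_tendsto hf.hasSum (.of_forall fun s => Finset.dvd_sum fun i _ => h i)
  · rw [tsum_eq_zero_of_not_summable hf]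
    exact dvd_zero _

variable [IsTopologicalRing R]

theorem X_pow_dvd_tsum_sub_sum {f : ι → R⟦X⟧} (hf : Summable f) {n : ℕ}
    (s : Finset ι) (h : ∀ i ∉ s, X ^ n ∣ f i) : X ^ n ∣ ∑' i, f i - ∑ i ∈ s, f i := by
  classical
  refine X_pow_dvd_of_tendsto (hf.hasSum.sub_const (∑ i ∈ s, f i)) ?_
  filter_upwards [eventually_ge_atTop s] with t ht
  rw [← Finset.sum_sdiff ht, add_sub_cancel_right]
  exact Finset.dvd_sum fun i hi => h i (Finset.mem_sdiff.mp hi).2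

theorem tsum_telescope {g : ℕ → R⟦X⟧} (h0 : g 0 = 0) (h : ∀ n, X ^ n ∣ g n) :
    ∑' n, (g (n + 1) - g n) = 0 := by
  have hg : Decays g := decays_of_X_pow_dvd h
  have hg' : Decays fun n => g (n + 1) := hg.comp_injective (add_left_injective 1)
  rw [hg'.summable.tsum_sub hg.summable, hg.summable.tsum_eq_zero_add, h0, zero_add, sub_self]

end Convergence

/-! ### Sections of power series -/

section Sections

variable {ι R : Type*} [CommRing R]

/-- The section `∑ f_n X ^ n ↦ ∑ f_{m n + r} X ^ n`. -/
noncomputable def sect (m r : ℕ) : R⟦X⟧ →+ R⟦X⟧ where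
  toFun f := mk fun n => coeff (m * n + r) f
  map_zero' := by ext; simp
  map_add' f g := by ext; simp

theorem coeff_sect (m r n : ℕ) (f : R⟦X⟧) : coeff n (sect m r f) = coeff (m * n + r) f := by
  simp [sect]

theorem sect_expand_mul {m r : ℕ} (hm : m ≠ 0) (hr : r < m) (f g : R⟦X⟧) :
    sect m r (expand m hm f * g) = f * sect m r g := by
  ext n
  rw [coeff_sect, coeff_mul, coeff_mul]
  symm
  refine Finset.sum_of_injOn (fun p => (m * p.1, m * p.2 + r)) ?_ ?_ ?_ ?_
  · rintro ⟨i, j⟩ - ⟨i', j'⟩ - h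
    simpa [hm] using h
  · rintro ⟨i, j⟩ h
    simp only [Finset.mem_coe, Finset.HasAntidiagonal.mem_antidiagonal] at h ⊢
    rw [← h]
    ring
  · rintro ⟨i, j⟩ h hn
    rw [Finset.HasAntidiagonal.mem_antidiagonal] at h
    rw [coeff_expand, if_neg, zero_mul]
    rintro ⟨c, rfl⟩
    have hc : c ≤ n := by
      by_contra! hc
      have := Nat.mul_le_mul_left m (Nat.succ_le_of_lt hc)
      grind
    refine hn ⟨(c, n - c), by simp [hc], Prod.ext rfl ?_⟩
    have : m * (n - c) + m * c = m * n := by rw [← mul_add, Nat.sub_add_cancel hc]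
    grind
  · rintro ⟨i, j⟩ -
    rw [coeff_sect, coeff_expand_mul]

theorem sect_X_pow_self {m : ℕ} (hm : m ≠ 0) (r : ℕ) : sect m r (X ^ r : R⟦X⟧) = 1 := by
  ext n
  rw [coeff_sect, coeff_X_pow, coeff_one]
  simp [hm]

theorem sect_X_pow_of_ne {m r j : ℕ} (hj : j % m ≠ r % m) : sect m r (X ^ j : R⟦X⟧) = 0 := by
  ext n
  rw [coeff_sect, coeff_X_pow, if_neg, map_zero]
  rintro rfl
  simp at hj

theorem sect_expand_mul_X_pow_self {m r : ℕ} (hm : m ≠ 0) (hr : r < m) (f : R⟦X⟧) :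
    sect m r (expand m hm f * X ^ r) = f := by
  rw [sect_expand_mul hm hr, sect_X_pow_self hm, mul_one]

theorem sect_expand_mul_X_pow_of_ne {m r j : ℕ} (hm : m ≠ 0) (hr : r < m) (hj : j % m ≠ r % m)
    (f : R⟦X⟧) : sect m r (expand m hm f * X ^ j) = 0 := by
  rw [sect_expand_mul hm hr, sect_X_pow_of_ne hj, mul_zero]

variable [TopologicalSpace R]

theorem continuous_sect (m r : ℕ) : Continuous (sect m r : R⟦X⟧ → R⟦X⟧) := by
  rw [continuous_iff_continuousAt]
  intro f
  rw [ContinuousAt, WithPiTopology.tendsto_iff_coeff_tendsto]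
  intro d
  simp only [coeff_sect]
  exact (WithPiTopology.continuous_coeff R _).tendsto f

theorem continuous_expand (k : ℕ) (hk : k ≠ 0) : Continuous (expand (R := R) k hk) := by
  rw [continuous_iff_continuousAt]
  intro f
  rw [ContinuousAt, WithPiTopology.tendsto_iff_coeff_tendsto]
  intro d
  simp only [coeff_expand]
  split_ifs
  · exact (WithPiTopology.continuous_coeff R _).tendsto f
  · exact tendsto_const_nhds

end Sections

/-! ### Infinite `q`-shifted factorials -/

theorem multipliable_qPochInf (a : ℤ⟦X⟧) {q : ℤ⟦X⟧} (hq : X ∣ q) :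
    Multipliable fun k : ℕ => 1 - a * q ^ k := by
  simp_rw [sub_eq_add_neg]
  apply WithPiTopology.multipliable_one_add_of_tendsto_order_atTop_nhds_top
  refine ENat.tendsto_nhds_top_iff_natCast_lt.mpr fun n => Filter.eventually_atTop.mpr
    ⟨n + 1, fun m hm => ?_⟩
  rw [order_neg]
  have h : (X : ℤ⟦X⟧) ^ m ∣ a * q ^ m := (pow_dvd_pow_of_dvd hq m).mul_left a
  rw [X_pow_dvd_iff] at h
  exact lt_of_lt_of_le (b := (m : ℕ∞)) (by exact_mod_cast hm) (nat_le_order _ _ h)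

theorem tendsto_qPoch (a : ℤ⟦X⟧) {q : ℤ⟦X⟧} (hq : X ∣ q) :
    Tendsto (qPoch a q) atTop (𝓝 (qPochInf a q)) :=
  (multipliable_qPochInf a hq).hasProd.tendsto_prod_nat

theorem qPoch_zero (a q : ℤ⟦X⟧) : qPoch a q 0 = 1 := by simp [qPoch]

theorem qPoch_succ (a q : ℤ⟦X⟧) (n : ℕ) : qPoch a q (n + 1) = qPoch a q n * (1 - a * q ^ n) :=
  Finset.prod_range_succ _ _

theorem qPoch_add (a q : ℤ⟦X⟧) (m n : ℕ) :
    qPoch a q (m + n) = qPoch a q m * qPoch (a * q ^ m) q n := by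
  simp only [qPoch, Finset.prod_range_add, pow_add, mul_assoc]

theorem qPochInf_eq_mul (a : ℤ⟦X⟧) {q : ℤ⟦X⟧} (hq : X ∣ q) (n : ℕ) :
    qPochInf a q = qPoch a q n * qPochInf (a * q ^ n) q := by
  refine tendsto_nhds_unique ((tendsto_qPoch a hq).comp (tendsto_add_atTop_nat n)) ?_
  refine ((tendsto_qPoch (a * q ^ n) hq).const_mul (qPoch a q n)).congr fun m => ?_
  rw [Function.comp_apply, ← qPoch_add, add_comm]

theorem X_pow_dvd_qPoch_sub_one {a : ℤ⟦X⟧} {n : ℕ} (ha : X ^ n ∣ a) (q : ℤ⟦X⟧) (m : ℕ) :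
    X ^ n ∣ qPoch a q m - 1 := by
  induction m with
  | zero => simp [qPoch_zero]
  | succ m ih =>
    have : qPoch a q (m + 1) - 1 = (qPoch a q m - 1) - qPoch a q m * q ^ m * a := by
      rw [qPoch_succ]
      ring
    rw [this]
    exact dvd_sub ih (ha.mul_left _)

theorem X_pow_dvd_qPochInf_sub_one {a q : ℤ⟦X⟧} (hq : X ∣ q) {n : ℕ} (ha : X ^ n ∣ a) :
    X ^ n ∣ qPochInf a q - 1 :=
  X_pow_dvd_of_tendsto ((tendsto_qPoch a hq).sub_const 1)
    (.of_forall fun m => X_pow_dvd_qPoch_sub_one ha q m)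

theorem X_pow_dvd_qPochInf_sub_qPoch (a : ℤ⟦X⟧) {q : ℤ⟦X⟧} (hq : X ∣ q) (n : ℕ) :
    X ^ n ∣ qPochInf a q - qPoch a q n := by
  have h : qPochInf a q - qPoch a q n = qPoch a q n * (qPochInf (a * q ^ n) q - 1) := by
    rw [qPochInf_eq_mul a hq n]
    ring
  rw [h]
  exact (X_pow_dvd_qPochInf_sub_one hq ((pow_dvd_pow_of_dvd hq n).mul_left a)).mul_left _

theorem isUnit_of_X_dvd_sub_one {f : ℤ⟦X⟧} (h : X ∣ f - 1) : IsUnit f := by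
  rw [isUnit_iff_constantCoeff]
  rw [X_dvd_iff, map_sub, map_one, sub_eq_zero] at h
  rw [h]
  exact isUnit_one

theorem isUnit_qPochInf {a q : ℤ⟦X⟧} (ha : X ∣ a) (hq : X ∣ q) : IsUnit (qPochInf a q) :=
  isUnit_of_X_dvd_sub_one (by
    simpa using X_pow_dvd_qPochInf_sub_one (n := 1) hq (by simpa using ha))

theorem isUnit_qPoch_of_X_dvd {a : ℤ⟦X⟧} (ha : X ∣ a) (q : ℤ⟦X⟧) (n : ℕ) : IsUnit (qPoch a q n) :=
  isUnit_of_X_dvd_sub_one (by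
    simpa using X_pow_dvd_qPoch_sub_one (n := 1) (by simpa using ha) q n)

theorem isUnit_one_sub_X_pow {n : ℕ} (hn : n ≠ 0) : IsUnit (1 - (X : ℤ⟦X⟧) ^ n) :=
  isUnit_of_X_dvd_sub_one (by
    rw [sub_sub_cancel_left]
    exact (dvd_pow_self X hn).neg_right)

theorem qPochInf_mul_qPochInf_neg (a : ℤ⟦X⟧) {q : ℤ⟦X⟧} (hq : X ∣ q) :
    qPochInf a q * qPochInf (-a) q = qPochInf (a ^ 2) (q ^ 2) := by
  rw [qPochInf, qPochInf, qPochInf,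
    ← (multipliable_qPochInf a hq).tprod_mul (multipliable_qPochInf (-a) hq)]
  exact tprod_congr fun k => by ring

theorem qPoch_mul_eq_prod (a q : ℤ⟦X⟧) (d n : ℕ) :
    qPoch a q (d * n) = ∏ i ∈ Finset.range d, qPoch (a * q ^ i) (q ^ d) n := by
  induction n with
  | zero => simp [qPoch_zero]
  | succ n ih =>
    simp only [qPoch_succ, Finset.prod_mul_distrib]
    rw [← ih, mul_add, mul_one, qPoch_add]
    congr 1
    exact Finset.prod_congr rfl fun i _ => by ring

theorem qPochInf_eq_prod (a : ℤ⟦X⟧) {q : ℤ⟦X⟧} (hq : X ∣ q) {d : ℕ} (hd : d ≠ 0) :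
    qPochInf a q = ∏ i ∈ Finset.range d, qPochInf (a * q ^ i) (q ^ d) := by
  have h : Tendsto (fun n => qPoch a q (d * n)) atTop (𝓝 (qPochInf a q)) :=
    (tendsto_qPoch a hq).comp (tendsto_id.const_mul_atTop' (Nat.pos_of_ne_zero hd))
  refine tendsto_nhds_unique h ?_
  simp only [qPoch_mul_eq_prod]
  exact tendsto_finsetProd _ fun i _ => tendsto_qPoch (a * q ^ i) (dvd_pow hq hd)

theorem expand_qPochInf (a : ℤ⟦X⟧) {q : ℤ⟦X⟧} (hq : X ∣ q) (k : ℕ) (hk : k ≠ 0) :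
    expand k hk (qPochInf a q) = qPochInf (expand k hk a) (expand k hk q) := by
  rw [qPochInf, qPochInf,
    (multipliable_qPochInf a hq).map_tprod (expand k hk) (continuous_expand k hk)]
  exact tprod_congr fun i => by simp

theorem expand_E {j : ℕ} (hj : j ≠ 0) (k : ℕ) (hk : k ≠ 0) : expand k hk (E j) = E (k * j) := by
  rw [E, E, expand_qPochInf _ (dvd_pow_self X hj)]
  simp [pow_mul]

/-! ### Gaussian binomial coefficients -/

section GaussBinom

variable {R : Type*} [CommRing R] (q : R)

/-- The Gaussian binomial coefficient `[N, i]_q`, defined by one of its two Pascal recurrences so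
that no division is needed. -/
def gaussBinom : ℕ → ℕ → R
  | _, 0 => 1
  | 0, _ + 1 => 0
  | N + 1, i + 1 => gaussBinom N (i + 1) + q ^ (N - i) * gaussBinom N i

theorem gaussBinom_zero_right (N : ℕ) : gaussBinom q N 0 = 1 := by cases N <;> rfl

theorem gaussBinom_succ_succ (N i : ℕ) : gaussBinom q (N + 1) (i + 1) =
    gaussBinom q N (i + 1) + q ^ (N - i) * gaussBinom q N i := rfl

theorem gaussBinom_eq_zero {N i : ℕ} (h : N < i) : gaussBinom q N i = 0 := by
  induction N generalizing i with
  | zero =>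
    obtain ⟨i, rfl⟩ := Nat.exists_eq_succ_of_ne_zero h.ne'
    rfl
  | succ N ih =>
    obtain ⟨i, rfl⟩ := Nat.exists_eq_succ_of_ne_zero (Nat.ne_zero_of_lt h)
    rw [Nat.succ_eq_add_one, gaussBinom_succ_succ, ih (by lia), ih (by lia), mul_zero, add_zero]

theorem gaussBinom_succ_succ' (N i : ℕ) : gaussBinom q (N + 1) (i + 1) =
    q ^ (i + 1) * gaussBinom q N (i + 1) + gaussBinom q N i := by
  induction N generalizing i with
  | zero =>
    rw [gaussBinom_succ_succ, gaussBinom_eq_zero q (show 0 < i + 1 by lia)]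
    simp
  | succ N ih =>
    rw [gaussBinom_succ_succ]
    cases i with
    | zero =>
      have h1 := ih 0
      have h2 := gaussBinom_succ_succ q N 0
      simp only [gaussBinom_zero_right, tsub_zero, zero_add, pow_one] at h1 h2 ⊢
      linear_combination h1 - q * h2
    | succ i =>
      have hz : (q ^ (N - i) * q ^ (i + 1) - q ^ (i + 2) * q ^ (N - (i + 1))) *
          gaussBinom q N (i + 1) = 0 := by
        rcases le_or_gt (i + 1) N with h | h
        · obtain ⟨k, rfl⟩ := Nat.exists_eq_add_of_le h
          rw [show i + 1 + k - i = k + 1 by lia, Nat.add_sub_cancel_left]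
          ring
        · rw [gaussBinom_eq_zero q h, mul_zero]
      rw [show N + 1 - (i + 1) = N - i by lia]
      linear_combination ih (i + 1) + q ^ (N - i) * ih i -
        q ^ (i + 2) * gaussBinom_succ_succ q N (i + 1) - gaussBinom_succ_succ q N i + hz

theorem map_gaussBinom {S : Type*} [CommRing S] (f : R →+* S) (N i : ℕ) :
    f (gaussBinom q N i) = gaussBinom (f q) N i := by
  induction N generalizing i with
  | zero => cases i <;> simp [gaussBinom]
  | succ N ih => cases i <;> simp [gaussBinom, ih]

theorem sum_gaussBinom_succ_mul (N : ℕ) (f : ℕ → R) :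
    ∑ i ∈ Finset.range (N + 1), gaussBinom q N (i + 1) * f (i + 1) + f 0 =
      ∑ i ∈ Finset.range (N + 1), gaussBinom q N i * f i := by
  rw [Finset.sum_range_succ _ N, gaussBinom_eq_zero _ (Nat.lt_succ_self N),
    Finset.sum_range_succ' _ N, gaussBinom_zero_right]
  ring

theorem sum_gaussBinom_mul_succ (N : ℕ) (f : ℕ → R) :
    ∑ i ∈ Finset.range (N + 2), gaussBinom q (N + 1) i * f i =
      ∑ i ∈ Finset.range (N + 1), gaussBinom q N i * (f i + q ^ (N - i) * f (i + 1)) := by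
  simp only [mul_add, Finset.sum_add_distrib]
  rw [Finset.sum_range_succ', gaussBinom_zero_right, ← sum_gaussBinom_succ_mul, one_mul,
    add_right_comm, ← Finset.sum_add_distrib]
  congr 1
  exact Finset.sum_congr rfl fun i _ => by
    rw [gaussBinom_succ_succ]
    ring

theorem sum_gaussBinom_mul_succ' (N : ℕ) (f : ℕ → R) :
    ∑ i ∈ Finset.range (N + 2), gaussBinom q (N + 1) i * f i =
      ∑ i ∈ Finset.range (N + 1), gaussBinom q N i * (q ^ i * f i + f (i + 1)) := by
  simp only [mul_add, Finset.sum_add_distrib]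
  rw [Finset.sum_range_succ', gaussBinom_zero_right,
    ← sum_gaussBinom_succ_mul q N fun i => q ^ i * f i, pow_zero, one_mul,
    add_right_comm, ← Finset.sum_add_distrib]
  congr 1
  exact Finset.sum_congr rfl fun i _ => by
    rw [gaussBinom_succ_succ']
    ring

end GaussBinom

theorem gaussBinom_mul_qPoch (q : ℤ⟦X⟧) (i k : ℕ) :
    gaussBinom q (i + k) i * (qPoch q q i * qPoch q q k) = qPoch q q (i + k) := by
  obtain ⟨N, hN⟩ : ∃ N, i + k = N := ⟨_, rfl⟩
  rw [hN]
  induction N generalizing i k with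
  | zero =>
    obtain ⟨rfl, rfl⟩ : i = 0 ∧ k = 0 := by lia
    simp [gaussBinom_zero_right, qPoch_zero]
  | succ N ih =>
    rcases i with _ | i
    · obtain rfl : k = N + 1 := by lia
      simp [gaussBinom_zero_right, qPoch_zero]
    rw [gaussBinom_succ_succ]
    have h1 := ih i k (by lia)
    rcases k with _ | k
    · obtain rfl : i = N := by lia
      rw [gaussBinom_eq_zero q (Nat.lt_succ_self i), qPoch_succ, Nat.sub_self]
      linear_combination (1 - q * q ^ i) * h1
    · have h2 := ih (i + 1) k (by lia)
      obtain rfl : N = i + k + 1 := by lia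
      rw [show i + k + 1 - i = k + 1 by lia]
      rw [qPoch_succ q q i] at h2 ⊢
      rw [qPoch_succ q q k] at h1 ⊢
      rw [qPoch_succ q q (i + k + 1)]
      linear_combination (1 - q * q ^ k) * h2 + q ^ (k + 1) * (1 - q * q ^ i) * h1

theorem X_pow_dvd_gaussBinom_mul_sub_one {q : ℤ⟦X⟧} (hq : X ∣ q) {M i k : ℕ} (hi : M ≤ i)
    (hk : M ≤ k) : X ^ M ∣ gaussBinom q (i + k) i * qPochInf q q - 1 := by
  have hd (n : ℕ) (hn : M ≤ n) : X ^ M ∣ qPochInf q q - qPoch q q n :=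
    (pow_dvd_pow X hn).trans (X_pow_dvd_qPochInf_sub_qPoch q hq n)
  rw [← (isUnit_qPochInf hq hq).dvd_mul_right]
  have : (gaussBinom q (i + k) i * qPochInf q q - 1) * qPochInf q q =
      gaussBinom q (i + k) i * (qPochInf q q * (qPochInf q q - qPoch q q k) +
        qPoch q q k * (qPochInf q q - qPoch q q i)) -
        (qPochInf q q - qPoch q q (i + k)) := by
    linear_combination gaussBinom_mul_qPoch q i k
  rw [this]
  exact dvd_sub ((((hd k hk).mul_left _).add ((hd i hi).mul_left _)).mul_left _) (hd _ (by lia))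

-- Tannery's theorem: only the finitely many `t j` not divisible by `X ^ M` matter modulo `X ^ M`.
theorem Decays.tendsto_sum_mul {α ι R : Type*} [CommRing R] [TopologicalSpace R] [T2Space R]
    [IsTopologicalRing R] {l : Filter α} {t : ι → R⟦X⟧} (ht : Decays t) {s : α → Finset ι}
    (hs : Tendsto s l atTop) {w : α → ι → R⟦X⟧}
    (hw : ∀ (M : ℕ) (j : ι), ∀ᶠ n in l, X ^ M ∣ w n j - 1) :
    Tendsto (fun n => ∑ j ∈ s n, w n j * t j) l (𝓝 (∑' j, t j)) := by
  refine tendsto_of_eventually_X_pow_dvd fun M => ?_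
  have hw' : ∀ᶠ n in l, ∀ j ∈ (ht M).toFinset, X ^ M ∣ w n j - 1 :=
    (Finset.eventually_all _).mpr fun j _ => hw M j
  filter_upwards [hs.eventually_ge_atTop (ht M).toFinset, hw'] with n hn hwn
  have htail : X ^ M ∣ ∑' j, t j - ∑ j ∈ s n, t j :=
    X_pow_dvd_tsum_sub_sum ht.summable (s n) fun j hj => by
      by_contra h
      exact hj (hn ((ht M).mem_toFinset.mpr h))
  have hhead : X ^ M ∣ ∑ j ∈ s n, (w n j - 1) * t j := Finset.dvd_sum fun j _ => by
    by_cases hj : X ^ M ∣ t j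
    · exact hj.mul_left _
    · exact (hwn j ((ht M).mem_toFinset.mpr hj)).mul_right _
  convert dvd_sub hhead htail using 1
  simp only [sub_mul, one_mul, Finset.sum_sub_distrib]
  ring

theorem sum_range_eq_sum_Icc {M : Type*} [AddCommMonoid M] (m n : ℕ) (f : ℕ → ℤ → M) :
    ∑ i ∈ Finset.range (m + n + 1), f i (i - n) =
      ∑ j ∈ Finset.Icc (-n : ℤ) m, f (j + n).toNat j := by
  refine Finset.sum_bij (fun i _ => (i : ℤ) - n) ?_ ?_ ?_ ?_
  · intro i hi
    rw [Finset.mem_range] at hi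
    rw [Finset.mem_Icc]
    lia
  · intro i _ i' _ h
    lia
  · intro j hj
    rw [Finset.mem_Icc] at hj
    exact ⟨(j + n).toNat, by rw [Finset.mem_range]; lia, by lia⟩
  · intro i _
    rw [sub_add_cancel, Int.toNat_natCast]

theorem tendsto_sum_gaussBinom {q : ℤ⟦X⟧} (hq : X ∣ q) {t : ℤ → ℤ⟦X⟧} (ht : Decays t) :
    Tendsto (fun n : ℕ => (∑ i ∈ Finset.range (n + (n + 1) + 1),
      gaussBinom q (n + (n + 1)) i * t (i - (n + 1 : ℕ))) * qPochInf q q) atTop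
      (𝓝 (∑' j, t j)) := by
  have hs : Tendsto (fun n : ℕ => Finset.Icc (-(n + 1 : ℕ) : ℤ) n) atTop atTop := by
    refine tendsto_atTop_finset_of_monotone ?_ fun j => ⟨j.natAbs, ?_⟩
    · exact fun m n h => Finset.Icc_subset_Icc (by lia) (by lia)
    · rw [Finset.mem_Icc]
      lia
  refine (ht.tendsto_sum_mul hs (w := fun n j =>
    gaussBinom q (n + (n + 1)) (j + (n + 1 : ℕ)).toNat * qPochInf q q) fun M j => ?_).congr
    fun n => ?_
  · filter_upwards [eventually_ge_atTop (j.natAbs + M)] with n hn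
    obtain ⟨k, hk⟩ : ∃ k, n + (n + 1) = (j + (n + 1 : ℕ)).toNat + k :=
      ⟨n + (n + 1) - (j + (n + 1 : ℕ)).toNat, by lia⟩
    rw [hk]
    exact X_pow_dvd_gaussBinom_mul_sub_one hq (by lia) (by lia)
  · rw [sum_range_eq_sum_Icc n (n + 1) fun i j => gaussBinom q (n + (n + 1)) i * t j,
      Finset.sum_mul]
    exact Finset.sum_congr rfl fun j _ => by ring

/-! ### The Jacobi triple product -/

/-- The triangular number `j (j + 1) / 2`. -/
def tri (j : ℤ) : ℕ := (j * (j + 1) / 2).toNat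

theorem two_mul_tri (j : ℤ) : 2 * (tri j : ℤ) = j * (j + 1) := by
  have h0 : 0 ≤ j * (j + 1) := by
    rcases le_or_gt 0 j with h | h
    · positivity
    · exact mul_nonneg_of_nonpos_of_nonpos h.le (by lia)
  have h2 : j * (j + 1) % 2 = 0 := Int.even_iff.mp (Int.even_mul_succ_self j)
  rw [tri]
  lia

theorem tri_eq (j : ℤ) : (tri j : ℤ) = tri (j - 1) + j := by
  have h1 := two_mul_tri j
  have h2 := two_mul_tri (j - 1)
  linarith

theorem tri_neg (j : ℤ) : tri (-j) = tri (j - 1) := by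
  have h1 := two_mul_tri (-j)
  have h2 := two_mul_tri (j - 1)
  have : 2 * (tri (-j) : ℤ) = 2 * tri (j - 1) := by linarith
  lia

theorem finite_tri_lt (n : ℕ) : {j : ℤ | tri j < n}.Finite := by
  refine (Set.finite_Icc (-(2 * n + 2 : ℤ)) (2 * n + 2)).subset fun j hj => ?_
  have h1 := two_mul_tri j
  have h2 : (tri j : ℤ) < n := by exact_mod_cast hj
  rw [Set.mem_Icc]
  constructor <;> nlinarith

section ThetaTerm

variable {R : Type*} [CommRing R]

/-- The general term of Ramanujan's theta function `f(a, b)`. -/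
def thetaTerm (a b : R) (j : ℤ) : R := a ^ tri j * b ^ tri (j - 1)

theorem thetaTerm_neg (a b : R) (j : ℤ) : thetaTerm a b (-j) = thetaTerm b a j := by
  rw [thetaTerm, thetaTerm, tri_neg, ← neg_add', tri_neg, add_sub_cancel_right, mul_comm]

theorem map_thetaTerm {S F : Type*} [CommRing S] [FunLike F R S] [MonoidHomClass F R S] (f : F)
    (a b : R) (j : ℤ) : f (thetaTerm a b j) = thetaTerm (f a) (f b) j := by
  simp only [thetaTerm, map_mul, map_pow]

theorem thetaTerm_mul_left (a b : R) {j : ℤ} {m k : ℕ} (h : (m : ℤ) + 1 = j + k) :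
    a * (a * b) ^ m * thetaTerm a b (j - 1) = (a * b) ^ k * thetaTerm a b j := by
  have h1 := tri_eq j
  have h2 := tri_eq (j - 1)
  have e1 : 1 + m + tri (j - 1) = k + tri j := by lia
  have e2 : m + tri (j - 1 - 1) = k + tri (j - 1) := by lia
  calc a * (a * b) ^ m * thetaTerm a b (j - 1)
      = a ^ (1 + m + tri (j - 1)) * b ^ (m + tri (j - 1 - 1)) := by rw [thetaTerm]; ring
    _ = _ := by rw [e1, e2, thetaTerm]; ring

theorem thetaTerm_mul_right (a b : R) {j : ℤ} {n i : ℕ} (h : (i : ℤ) = n + j) :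
    b * (a * b) ^ n * thetaTerm a b j = (a * b) ^ i * thetaTerm a b (j - 1) := by
  have h1 := tri_eq j
  have h2 := tri_eq (j - 1)
  have e1 : n + tri j = i + tri (j - 1) := by lia
  have e2 : 1 + n + tri (j - 1) = i + tri (j - 1 - 1) := by lia
  calc b * (a * b) ^ n * thetaTerm a b j
      = a ^ (n + tri j) * b ^ (1 + n + tri (j - 1)) := by rw [thetaTerm]; ring
    _ = _ := by rw [e1, e2, thetaTerm]; ring

theorem finite_triple_product (a b : R) (m n : ℕ) :
    (∏ k ∈ Finset.range m, (1 + a * (a * b) ^ k)) * ∏ k ∈ Finset.range n, (1 + b * (a * b) ^ k) =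
      ∑ i ∈ Finset.range (m + n + 1), gaussBinom (a * b) (m + n) i * thetaTerm a b (i - n) := by
  induction m with
  | zero =>
    simp only [zero_add, Finset.prod_range_zero, one_mul]
    induction n with
    | zero => simp [gaussBinom_zero_right, thetaTerm, tri]
    | succ n ih =>
      rw [Finset.prod_range_succ, ih, sum_gaussBinom_mul_succ', Finset.sum_mul]
      refine Finset.sum_congr rfl fun i _ => ?_
      have h := thetaTerm_mul_right a b (j := i - n) (n := n) (i := i) (by ring)
      rw [show ((i + 1 : ℕ) : ℤ) - (n + 1 : ℕ) = i - n by push_cast; ring,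
        show (i : ℤ) - (n + 1 : ℕ) = i - n - 1 by push_cast; ring]
      linear_combination gaussBinom (a * b) n i * h
  | succ m ih =>
    rw [Finset.prod_range_succ, mul_right_comm, ih, add_right_comm m 1 n, sum_gaussBinom_mul_succ,
      Finset.sum_mul]
    refine Finset.sum_congr rfl fun i hi => ?_
    have hi := Finset.mem_range.mp hi
    have h := thetaTerm_mul_left a b (j := (i + 1 : ℕ) - n) (m := m) (k := m + n - i)
      (by push_cast; lia)
    rw [show ((i + 1 : ℕ) : ℤ) - n - 1 = i - n by push_cast; ring] at h
    linear_combination gaussBinom (a * b) (m + n) i * h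

end ThetaTerm

theorem decays_thetaTerm {a b : ℤ⟦X⟧} (hab : X ∣ a * b) : Decays (thetaTerm a b) := by
  have h : Decays fun j : ℤ => (X : ℤ⟦X⟧) ^ min (tri j) (tri (j - 1)) := by
    refine decays_X_pow fun n => ((finite_tri_lt n).union
      ((finite_tri_lt n).preimage (sub_left_injective (b := (1 : ℤ))).injOn)).subset fun j hj => ?_
    simpa only [Set.mem_union, Set.mem_preimage, Set.mem_ofPred_eq, min_lt_iff] using hj
  refine h.of_dvd fun j => (pow_dvd_pow_of_dvd hab _).trans ?_
  rw [mul_pow]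
  exact mul_dvd_mul (pow_dvd_pow _ (min_le_left _ _)) (pow_dvd_pow _ (min_le_right _ _))

/-- Ramanujan's theta function `f(a, b) = ∑_{j ∈ ℤ} a ^ (j (j + 1) / 2) b ^ (j (j - 1) / 2)`; the
series converges when `X ∣ a * b`. -/
noncomputable def theta (a b : ℤ⟦X⟧) : ℤ⟦X⟧ := ∑' j : ℤ, thetaTerm a b j

theorem theta_comm (a b : ℤ⟦X⟧) : theta a b = theta b a := by
  rw [theta, ← (Equiv.neg ℤ).tsum_eq]
  exact tsum_congr fun j => thetaTerm_neg a b j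

theorem expand_theta {a b : ℤ⟦X⟧} (hab : X ∣ a * b) {k : ℕ} (hk : k ≠ 0) :
    expand k hk (theta a b) = theta (expand k hk a) (expand k hk b) := by
  rw [theta, (decays_thetaTerm hab).summable.map_tsum (expand k hk) (continuous_expand k hk)]
  exact tsum_congr fun j => map_thetaTerm _ a b j

theorem qPoch_neg (a q : ℤ⟦X⟧) (n : ℕ) :
    qPoch (-a) q n = ∏ k ∈ Finset.range n, (1 + a * q ^ k) :=
  Finset.prod_congr rfl fun k _ => by ring

theorem theta_eq_qPochInf {a b : ℤ⟦X⟧} (hab : X ∣ a * b) :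
    theta a b = qPochInf (-a) (a * b) * qPochInf (-b) (a * b) * qPochInf (a * b) (a * b) := by
  refine tendsto_nhds_unique (tendsto_sum_gaussBinom hab (decays_thetaTerm hab)) ?_
  simp only [← finite_triple_product, ← qPoch_neg]
  exact (((tendsto_qPoch (-a) hab).mul
    ((tendsto_qPoch (-b) hab).comp (tendsto_add_atTop_nat 1))).mul_const _)

theorem theta_neg_one {b : ℤ⟦X⟧} (hb : X ∣ b) : theta (-1) b = 0 := by
  have hab : X ∣ -1 * b := hb.mul_left _
  rw [theta_eq_qPochInf hab, qPochInf_eq_mul (- -1) hab 1]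
  simp [qPoch]

/-! ### Identities between theta functions -/

theorem Decays.tsum_eq_sum {ι κ R : Type*} [CommRing R] [TopologicalSpace R]
    [IsTopologicalRing R] [T2Space R] {d : ℕ} {f : ι → R⟦X⟧} (hf : Decays f) {e : Fin d × κ → ι}
    (he : Function.Bijective e) : ∑' i, f i = ∑ r : Fin d, ∑' k, f (e (r, k)) := by
  rw [← (Equiv.ofBijective e he).tsum_eq f]
  have := (hf.comp_injective he.injective).tsum_prod
  simp only [Function.comp_def] at this
  simp only [Equiv.ofBijective_apply, this, tsum_fintype]

theorem theta_mul_theta {a b a' b' : ℤ⟦X⟧} (h : X ∣ a * b) (h' : X ∣ a' * b') :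
    theta a b * theta a' b' = ∑' p : ℤ × ℤ, thetaTerm a b p.1 * thetaTerm a' b' p.2 :=
  (decays_thetaTerm h).tsum_mul_tsum (decays_thetaTerm h')

theorem theta_one_left {b : ℤ⟦X⟧} (hb : X ∣ b) : theta 1 b = 2 * theta b (b ^ 3) := by
  have he : Function.Bijective fun p : Fin 2 × ℤ => 2 * p.2 + p.1.val := by
    constructor
    · rintro ⟨r, m⟩ ⟨r', m'⟩ h
      fin_cases r <;> fin_cases r' <;> simp at h ⊢ <;> lia
    · intro j
      rcases Int.emod_two_eq_zero_or_one j with h | h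
      · exact ⟨(0, j / 2), by simp; lia⟩
      · exact ⟨(1, j / 2), by simp; lia⟩
  have h0 (m : ℤ) : thetaTerm 1 b (2 * m) = thetaTerm b (b ^ 3) m := by
    have e : tri (2 * m - 1) = tri m + 3 * tri (m - 1) := by
      zify
      linarith [two_mul_tri (2 * m - 1), two_mul_tri m, two_mul_tri (m - 1)]
    simp only [thetaTerm, e]
    ring
  have h1 (m : ℤ) : thetaTerm 1 b (2 * m + 1) = thetaTerm (b ^ 3) b m := by
    have e : tri (2 * m + 1 - 1) = 3 * tri m + tri (m - 1) := by
      zify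
      linarith [two_mul_tri (2 * m + 1 - 1), two_mul_tri m, two_mul_tri (m - 1)]
    simp only [thetaTerm, e]
    ring
  rw [theta, (decays_thetaTerm (hb.mul_left 1)).tsum_eq_sum he]
  simp only [Fin.sum_univ_two, Fin.val_zero, Fin.val_one, Nat.cast_zero, Nat.cast_one, add_zero,
    h0, h1]
  change theta b (b ^ 3) + theta (b ^ 3) b = _
  rw [theta_comm (b ^ 3)]
  ring

theorem bijective_add_add_sub :
    Function.Bijective fun p : Fin 2 × ℤ × ℤ => (p.2.1 + p.2.2 + p.1.val, p.2.1 - p.2.2) := by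
  constructor
  · rintro ⟨r, m, n⟩ ⟨r', m', n'⟩ h
    simp only [Prod.mk.injEq] at h
    fin_cases r <;> fin_cases r' <;> simp at h ⊢ <;> lia
  · rintro ⟨a, b⟩
    rcases Int.emod_two_eq_zero_or_one (a + b) with h | h
    · exact ⟨(0, (a + b) / 2, (a - b) / 2), by simp; lia⟩
    · exact ⟨(1, (a + b - 1) / 2, (a - b - 1) / 2), by simp; lia⟩

theorem thetaTerm_add_mul_thetaTerm_sub (a e g : ℤ⟦X⟧) (m n : ℤ) :
    thetaTerm a (a * e * g) (m + n) * thetaTerm (a * g) (a * e) (m - n) =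
      thetaTerm (a ^ 2 * g) (a ^ 2 * e ^ 2 * g) m *
        thetaTerm (a ^ 2 * e) (a ^ 2 * e * g ^ 2) n := by
  have h1 := two_mul_tri (m + n)
  have h2 := two_mul_tri (m + n - 1)
  have h3 := two_mul_tri (m - n)
  have h4 := two_mul_tri (m - n - 1)
  have h5 := two_mul_tri m
  have h6 := two_mul_tri (m - 1)
  have h7 := two_mul_tri n
  have h8 := two_mul_tri (n - 1)
  have ha : tri (m + n) + tri (m + n - 1) + tri (m - n) + tri (m - n - 1) =
      2 * tri m + 2 * tri (m - 1) + 2 * tri n + 2 * tri (n - 1) := by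
    zify
    linarith
  have he : tri (m + n - 1) + tri (m - n - 1) = 2 * tri (m - 1) + tri n + tri (n - 1) := by
    zify
    linarith
  have hg : tri (m + n - 1) + tri (m - n) = tri m + tri (m - 1) + 2 * tri (n - 1) := by
    zify
    linarith
  calc _ = a ^ (tri (m + n) + tri (m + n - 1) + tri (m - n) + tri (m - n - 1)) *
        e ^ (tri (m + n - 1) + tri (m - n - 1)) * g ^ (tri (m + n - 1) + tri (m - n)) := by
        simp only [thetaTerm]
        ring
    _ = _ := by
        rw [ha, he, hg]
        simp only [thetaTerm]
        ring

theorem thetaTerm_add_one_mul_thetaTerm_sub (a e g : ℤ⟦X⟧) (m n : ℤ) :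
    thetaTerm a (a * e * g) (m + n + 1) * thetaTerm (a * g) (a * e) (m - n) =
      a * (thetaTerm (a ^ 4 * e * g ^ 2) e m * thetaTerm (a ^ 4 * e ^ 2 * g) g n) := by
  have h1 := two_mul_tri (m + n + 1)
  have h2 := two_mul_tri (m + n + 1 - 1)
  have h3 := two_mul_tri (m - n)
  have h4 := two_mul_tri (m - n - 1)
  have h5 := two_mul_tri m
  have h6 := two_mul_tri (m - 1)
  have h7 := two_mul_tri n
  have h8 := two_mul_tri (n - 1)
  have ha : tri (m + n + 1) + tri (m + n + 1 - 1) + tri (m - n) + tri (m - n - 1) =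
      4 * tri m + 4 * tri n + 1 := by
    zify
    linarith
  have he : tri (m + n + 1 - 1) + tri (m - n - 1) = tri m + tri (m - 1) + 2 * tri n := by
    zify
    linarith
  have hg : tri (m + n + 1 - 1) + tri (m - n) = 2 * tri m + tri n + tri (n - 1) := by
    zify
    linarith
  calc _ = a ^ (tri (m + n + 1) + tri (m + n + 1 - 1) + tri (m - n) + tri (m - n - 1)) *
        e ^ (tri (m + n + 1 - 1) + tri (m - n - 1)) * g ^ (tri (m + n + 1 - 1) + tri (m - n)) := by
        simp only [thetaTerm]
        ring
    _ = _ := by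
        rw [ha, he, hg]
        simp only [thetaTerm]
        ring

-- The cosets of the sublattice of `ℤ ^ 2` given by `j + k` even.
theorem theta_mul_theta_eq_add {a e g : ℤ⟦X⟧} (ha : X ∣ a) :
    theta a (a * e * g) * theta (a * g) (a * e) =
      theta (a ^ 2 * g) (a ^ 2 * e ^ 2 * g) * theta (a ^ 2 * e) (a ^ 2 * e * g ^ 2) +
        a * (theta (a ^ 4 * e * g ^ 2) e * theta (a ^ 4 * e ^ 2 * g) g) := by
  have ha2 : X ∣ a ^ 2 := dvd_pow ha two_ne_zero
  have ha4 : X ∣ a ^ 4 := dvd_pow ha four_ne_zero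
  have h1 : X ∣ a * (a * e * g) := ha.mul_right _
  have h2 : X ∣ a * g * (a * e) := (ha.mul_right _).mul_right _
  have h3 : X ∣ a ^ 4 * e * g ^ 2 * e := ((ha4.mul_right _).mul_right _).mul_right _
  have h4 : X ∣ a ^ 4 * e ^ 2 * g * g := ((ha4.mul_right _).mul_right _).mul_right _
  rw [theta_mul_theta h1 h2,
    ((decays_thetaTerm h1).mul (decays_thetaTerm h2)).tsum_eq_sum bijective_add_add_sub,
    theta_mul_theta ((ha2.mul_right _).mul_right _) ((ha2.mul_right _).mul_right _),
    theta_mul_theta h3 h4,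
    ← ((decays_thetaTerm h3).mul (decays_thetaTerm h4)).summable.tsum_mul_left]
  simp only [Fin.sum_univ_two, Fin.val_zero, Fin.val_one, Nat.cast_zero, Nat.cast_one, add_zero,
    thetaTerm_add_mul_thetaTerm_sub, thetaTerm_add_one_mul_thetaTerm_sub]

theorem bijective_five_mul_add :
    Function.Bijective fun p : Fin 5 × ℤ => 5 * p.2 + ((p.1.val : ℤ) - 2) := by
  constructor
  · rintro ⟨r, m⟩ ⟨r', m'⟩ h
    simp only at h
    obtain rfl : r = r' := Fin.ext (by omega)
    simp only [Prod.mk.injEq, true_and]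
    lia
  · intro j
    exact ⟨(⟨((j + 2) % 5).toNat, by lia⟩, (j + 2) / 5), by simp only; lia⟩

theorem thetaTerm_five_mul_add (a b : ℤ⟦X⟧) (m : ℤ) (r : Fin 5) :
    thetaTerm a b (5 * m + (r.val - 2)) = thetaTerm a b (r.val - 2) *
      thetaTerm (a ^ (5 + 5 * r.val) * b ^ (5 * r.val))
        (a ^ (5 * (4 - r.val)) * b ^ (5 + 5 * (4 - r.val))) m := by
  have hr : r.val ≤ 4 := by lia
  have h5 := two_mul_tri m
  have h6 := two_mul_tri (m - 1)
  have ha : tri (5 * m + (r.val - 2)) =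
      tri (r.val - 2) + (5 + 5 * r.val) * tri m + 5 * (4 - r.val) * tri (m - 1) := by
    zify [hr]
    refine mul_left_cancel₀ (two_ne_zero (α := ℤ)) ?_
    linear_combination two_mul_tri (5 * m + (r.val - 2)) - two_mul_tri (r.val - 2) -
      (5 + 5 * r.val) * h5 - 5 * (4 - r.val) * h6
  have hb : tri (5 * m + (r.val - 2) - 1) =
      tri (r.val - 2 - 1) + 5 * r.val * tri m + (5 + 5 * (4 - r.val)) * tri (m - 1) := by
    zify [hr]
    refine mul_left_cancel₀ (two_ne_zero (α := ℤ)) ?_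
    linear_combination two_mul_tri (5 * m + (r.val - 2) - 1) - two_mul_tri (r.val - 2 - 1) -
      5 * r.val * h5 - (5 + 5 * (4 - r.val)) * h6
  rw [thetaTerm, ha, hb]
  simp only [thetaTerm, mul_pow, ← pow_mul, pow_add]
  ring

theorem theta_five_dissection {a b : ℤ⟦X⟧} (h : X ∣ a * b) :
    theta a b = theta (a ^ 15 * b ^ 10) (a ^ 10 * b ^ 15) +
      a * theta (a ^ 20 * b ^ 15) (a ^ 5 * b ^ 10) +
      b * theta (a ^ 10 * b ^ 5) (a ^ 15 * b ^ 20) +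
      a ^ 3 * b * theta (a ^ 25 * b ^ 20) (b ^ 5) +
      a * b ^ 3 * theta (a ^ 5) (a ^ 20 * b ^ 25) := by
  have hsum (r : Fin 5) : Summable (thetaTerm (a ^ (5 + 5 * r.val) * b ^ (5 * r.val))
      (a ^ (5 * (4 - r.val)) * b ^ (5 + 5 * (4 - r.val)))) := by
    refine (decays_thetaTerm (h.trans (mul_dvd_mul ?_ ?_))).summable
    · exact (dvd_pow_self a (by lia)).mul_right _
    · exact (dvd_pow_self b (by lia)).mul_left _
  have key : theta a b = ∑ r : Fin 5, thetaTerm a b (r.val - 2) *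
      theta (a ^ (5 + 5 * r.val) * b ^ (5 * r.val))
        (a ^ (5 * (4 - r.val)) * b ^ (5 + 5 * (4 - r.val))) := by
    rw [theta, (decays_thetaTerm h).tsum_eq_sum bijective_five_mul_add]
    refine Finset.sum_congr rfl fun r _ => ?_
    simp only [thetaTerm_five_mul_add]
    exact (hsum r).tsum_mul_left _
  rw [key, Fin.sum_univ_five]
  simp [thetaTerm, tri]
  ring

theorem theta_self_five_dissection {a : ℤ⟦X⟧} (ha : X ∣ a) :
    theta a a = theta (a ^ 25) (a ^ 25) + 2 * a * theta (a ^ 15) (a ^ 35) +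
      2 * a ^ 4 * theta (a ^ 5) (a ^ 45) := by
  rw [theta_five_dissection (ha.mul_right a)]
  ring_nf
  rw [theta_comm (a ^ 35), theta_comm (a ^ 45)]
  ring

theorem theta_one_five_dissection {a : ℤ⟦X⟧} (ha : X ∣ a) :
    theta 1 a = 2 * theta (a ^ 10) (a ^ 15) + 2 * a * theta (a ^ 5) (a ^ 20) +
      a ^ 3 * theta 1 (a ^ 25) := by
  rw [theta_five_dissection (ha.mul_left 1)]
  simp only [one_pow, one_mul]
  rw [theta_comm (a ^ 15), theta_comm (a ^ 20)]
  ring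

-- The cosets of the ideal `(2 - i)` of `ℤ[i]`, with representatives `v`.
theorem bijective_two_mul_add {v : Fin 5 → ℤ × ℤ}
    (hv : Function.Injective fun r => ((v r).1 + 2 * (v r).2 : ZMod 5)) :
    Function.Bijective fun p : Fin 5 × ℤ × ℤ =>
      (2 * p.2.1 + p.2.2 + (v p.1).1, 2 * p.2.2 - p.2.1 + (v p.1).2) := by
  constructor
  · rintro ⟨r, m, n⟩ ⟨r', m', n'⟩ h
    simp only [Prod.mk.injEq] at h
    obtain rfl : r = r' := hv (by
      have : (5 : ℤ) ∣ (v r').1 + 2 * (v r').2 - ((v r).1 + 2 * (v r).2) :=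
        ⟨n - n', by linarith⟩
      exact_mod_cast (ZMod.intCast_eq_intCast_iff_dvd_sub _ _ 5).mpr this)
    simp only [Prod.mk.injEq, true_and]
    lia
  · rintro ⟨x, y⟩
    obtain ⟨r, hr⟩ := (Finite.injective_iff_surjective (α := Fin 5)).mp hv (x + 2 * y : ZMod 5)
    have : (5 : ℤ) ∣ x + 2 * y - ((v r).1 + 2 * (v r).2) :=
      (ZMod.intCast_eq_intCast_iff_dvd_sub _ _ 5).mp (by exact_mod_cast hr)
    refine ⟨(r, (2 * (x - (v r).1) - (y - (v r).2)) / 5,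
      (x - (v r).1 + 2 * (y - (v r).2)) / 5), ?_⟩
    simp only [Prod.mk.injEq]
    lia

theorem thetaTerm_pow (a : ℤ⟦X⟧) (i j : ℕ) (n : ℤ) :
    thetaTerm (a ^ i) (a ^ j) n = a ^ (i * tri n + j * tri (n - 1)) := by
  rw [thetaTerm, ← pow_mul, ← pow_mul, pow_add]

theorem theta_pow_sq_eq_sum {a : ℤ⟦X⟧} (ha : X ∣ a) {i j : ℕ} (v : Fin 5 → ℤ × ℤ)
    (hv : Function.Injective fun r => ((v r).1 + 2 * (v r).2 : ZMod 5)) (k : Fin 5 → ℕ)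
    (s t : Fin 5 → ℕ × ℕ)
    (hij : i + j ≠ 0) (hs : ∀ r, (s r).1 + (s r).2 ≠ 0) (ht : ∀ r, (t r).1 + (t r).2 ≠ 0)
    (h : ∀ r m n, ∀ x y : ℤ, x = 2 * m + n + (v r).1 → y = 2 * n - m + (v r).2 →
      i * (x * (x + 1) + y * (y + 1)) + j * (x * (x - 1) + y * (y - 1)) =
      2 * k r + (s r).1 * (m * (m + 1)) + (s r).2 * (m * (m - 1)) +
        (t r).1 * (n * (n + 1)) + (t r).2 * (n * (n - 1))) :
    theta (a ^ i) (a ^ j) ^ 2 = ∑ r, a ^ k r *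
      (theta (a ^ (s r).1) (a ^ (s r).2) * theta (a ^ (t r).1) (a ^ (t r).2)) := by
  have hX {i j : ℕ} (hij : i + j ≠ 0) : X ∣ a ^ i * a ^ j := by
    rw [← pow_add]
    exact dvd_pow ha hij
  have hd := decays_thetaTerm (hX hij)
  rw [sq, theta_mul_theta (hX hij) (hX hij), (hd.mul hd).tsum_eq_sum (bijective_two_mul_add hv)]
  refine Finset.sum_congr rfl fun r _ => ?_
  rw [theta_mul_theta (hX (hs r)) (hX (ht r)),
    ← ((decays_thetaTerm (hX (hs r))).mul (decays_thetaTerm (hX (ht r)))).summable.tsum_mul_left]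
  refine tsum_congr fun ⟨m, n⟩ => ?_
  obtain ⟨x, hx⟩ : ∃ x, x = 2 * m + n + (v r).1 := ⟨_, rfl⟩
  obtain ⟨y, hy⟩ : ∃ y, y = 2 * n - m + (v r).2 := ⟨_, rfl⟩
  simp only [← hx, ← hy, thetaTerm_pow, ← pow_add]
  congr 1
  zify
  refine mul_left_cancel₀ (two_ne_zero (α := ℤ)) ?_
  linear_combination h r m n x y hx hy + i * (two_mul_tri x + two_mul_tri y) +
    j * (two_mul_tri (x - 1) + two_mul_tri (y - 1)) - (s r).1 * two_mul_tri m -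
    (s r).2 * two_mul_tri (m - 1) - (t r).1 * two_mul_tri n - (t r).2 * two_mul_tri (n - 1)

theorem theta_one_sq {a : ℤ⟦X⟧} (ha : X ∣ a) : theta 1 a ^ 2 =
    a * theta 1 (a ^ 5) ^ 2 + 4 * (theta a (a ^ 4) * theta (a ^ 2) (a ^ 3)) := by
  have h := theta_pow_sq_eq_sum ha (i := 0) (j := 1)
    ![(0, 0), (-1, 0), (1, 1), (0, 1), (1, 0)] (by decide) ![0, 1, 0, 0, 0]
    ![(2, 3), (0, 5), (3, 2), (1, 4), (4, 1)] ![(1, 4), (0, 5), (4, 1), (3, 2), (2, 3)]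
    (by decide) (by decide) (by decide) (by
      rintro r m n x y rfl rfl
      fin_cases r <;> simp <;> ring_nf)
  simp only [pow_zero, pow_one, Fin.sum_univ_five, Fin.isValue, Matrix.cons_val_zero, one_mul,
    Matrix.cons_val_one, Matrix.cons_val] at h
  rw [h, theta_comm (a ^ 3), theta_comm (a ^ 4)]
  ring

theorem theta_self_sq {a : ℤ⟦X⟧} (ha : X ∣ a) : theta a a ^ 2 =
    theta (a ^ 5) (a ^ 5) ^ 2 + 4 * a * (theta (a ^ 3) (a ^ 7) * theta a (a ^ 9)) := by
  have h := theta_pow_sq_eq_sum ha (i := 1) (j := 1)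
    ![(0, 0), (0, -1), (0, 1), (1, 0), (-1, 0)] (by decide) ![0, 1, 1, 1, 1]
    ![(5, 5), (7, 3), (3, 7), (9, 1), (1, 9)] ![(5, 5), (1, 9), (9, 1), (7, 3), (3, 7)]
    (by decide) (by decide) (by decide) (by
      rintro r m n x y rfl rfl
      fin_cases r <;> simp <;> ring_nf)
  simp only [pow_zero, pow_one, Fin.sum_univ_five, Fin.isValue, Matrix.cons_val_zero, one_mul,
    Matrix.cons_val_one, Matrix.cons_val] at h
  rw [h, theta_comm (a ^ 7), theta_comm (a ^ 9)]
  ring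

/-- Ramanujan's theta function `ψ(q) = ∑_{n ≥ 0} q ^ (n (n + 1) / 2)`, written as the bilateral
series `f(q, q ^ 3)`. -/
noncomputable def psi : ℤ⟦X⟧ := theta X (X ^ 3)

instance : CharZero ℤ⟦X⟧ := charZero_of_injective_ringHom C_injective

theorem E_one_mul_qPochInf_neg : E 1 * qPochInf (-X) X = E 2 := by
  rw [E, E, pow_one, qPochInf_mul_qPochInf_neg X dvd_rfl]

theorem E_one_eq : E 1 = qPochInf X (X ^ 2) * E 2 := by
  rw [E, E, pow_one, qPochInf_eq_prod X dvd_rfl two_ne_zero]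
  simp [Finset.prod_range_succ, sq]

theorem theta_neg_X_neg_X_mul_E_two : theta (-X) (-X) * E 2 = E 1 ^ 2 := by
  rw [theta_eq_qPochInf (by simp), neg_neg, neg_mul_neg, ← sq X, E_one_eq, E]
  ring

theorem two_mul_psi : 2 * psi = theta 1 X :=
  (theta_one_left dvd_rfl).symm

theorem psi_mul_E_one : psi * E 1 = E 2 ^ 2 := by
  refine mul_left_cancel₀ two_ne_zero ?_
  have h : qPochInf (-1) X = 2 * qPochInf (-X) X := by
    rw [qPochInf_eq_mul (-1) dvd_rfl 1]
    norm_num [qPoch]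
  rw [← mul_assoc, two_mul_psi, theta_eq_qPochInf (by simp), one_mul, h, ← E_one_mul_qPochInf_neg,
    E, pow_one]
  ring

/-! ### A Bailey pair -/

section PartialFractions

variable {K : Type*} [Field K] {q : K}

theorem thetaTerm_sub_one (hq : q ≠ 0) (j : ℤ) :
    thetaTerm (-q) (-1) j = -q ^ j * thetaTerm (-q) (-1) (j - 1) := by
  have h := thetaTerm_mul_left (-q) (-1) (j := j) (m := j.toNat) (k := (j.toNat + 1 - j).toNat)
    (by lia)
  rw [neg_mul_neg, mul_one] at h
  refine mul_left_cancel₀ (pow_ne_zero (j.toNat + 1 - j).toNat hq) ?_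
  rw [← h, ← mul_assoc, mul_neg, ← zpow_natCast, ← zpow_natCast, ← zpow_add₀ hq,
    show ((j.toNat + 1 - j).toNat : ℤ) + j = j.toNat + 1 by lia, zpow_add_one₀ hq]
  ring

theorem one_sub_mul_prod (z : K) (n : ℕ) :
    (1 - z) * ∏ k ∈ Finset.range n, (1 - z * q * q ^ k) =
      (∏ k ∈ Finset.range n, (1 - z * q ^ k)) * (1 - z * q ^ n) := by
  rw [← Finset.prod_range_succ, Finset.prod_range_succ', pow_zero, mul_one, mul_comm]
  congr 1
  exact Finset.prod_congr rfl fun k _ => by ring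

variable (q) in
/-- The sum over all poles `z = q ^ (-j)`, `-n ≤ j ≤ m`, of the partial fraction expansion of
`(q; q)_{m+n} / ((z; q)_{m+1} (q/z; q)_n)`. -/
def poleSum (m n : ℕ) (z : K) : K :=
  ∑ i ∈ Finset.range (m + n + 1),
    gaussBinom q (m + n) i * (thetaTerm (-q) (-1) (i - n) / (1 - z * q ^ (i - n : ℤ)))

theorem poleSum_succ_left (hq : q ≠ 0) (m n : ℕ) (z : K) :
    poleSum q (m + 1) n z = poleSum q m n z - q ^ (m + 1) * poleSum q m n (z * q) := by
  simp only [poleSum]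
  rw [add_right_comm m 1 n, sum_gaussBinom_mul_succ, Finset.mul_sum, ← Finset.sum_sub_distrib]
  refine Finset.sum_congr rfl fun i hi => ?_
  have hi := Finset.mem_range.mp hi
  have hj : ((i + 1 : ℕ) : ℤ) - n = i - n + 1 := by push_cast; ring
  have hpow : q ^ (m + n - i) * q ^ (i - n + 1 : ℤ) = q ^ (m + 1) := by
    rw [← zpow_natCast, ← zpow_natCast, ← zpow_add₀ hq]
    congr 1
    lia
  rw [hj, thetaTerm_sub_one hq (i - n + 1), add_sub_cancel_right, ← hpow, zpow_add_one₀ hq]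
  ring

theorem poleSum_succ_right (hq : q ≠ 0) (m n : ℕ) (z : K) :
    poleSum q m (n + 1) z = poleSum q m n z - q ^ n * poleSum q m n (z / q) := by
  simp only [poleSum]
  rw [← add_assoc m n 1, sum_gaussBinom_mul_succ', Finset.mul_sum, ← Finset.sum_sub_distrib]
  refine Finset.sum_congr rfl fun i _ => ?_
  have hpow : q ^ i = q ^ n * q ^ (i - n : ℤ) := by
    rw [← zpow_natCast, ← zpow_natCast, ← zpow_add₀ hq, add_sub_cancel]
  rw [show ((i + 1 : ℕ) : ℤ) - (n + 1 : ℕ) = i - n by push_cast; ring,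
    show (i : ℤ) - (n + 1 : ℕ) = i - n - 1 by push_cast; ring, thetaTerm_sub_one hq (i - n), hpow,
    zpow_sub_one₀ hq, div_mul_eq_mul_div, mul_comm _ q⁻¹, ← mul_assoc, ← div_eq_mul_inv]
  ring

theorem poleSum_zero_right_mul_prod (hq : q ≠ 0) (m : ℕ) {z : K}
    (hz : ∀ j : ℤ, 1 - z * q ^ j ≠ 0) :
    poleSum q m 0 z * ∏ k ∈ Finset.range (m + 1), (1 - z * q ^ k) =
      ∏ k ∈ Finset.range m, (1 - q * q ^ k) := by
  induction m generalizing z with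
  | zero =>
    have := hz 0
    rw [zpow_zero, mul_one] at this
    simp [poleSum, gaussBinom_zero_right, thetaTerm, tri, this]
  | succ m ih =>
    have h1 := ih hz
    have h2 := ih (z := z * q) fun j => by
      rw [mul_assoc, ← zpow_one_add₀ hq]
      exact hz _
    have h3 := one_sub_mul_prod (q := q) z (m + 1)
    rw [poleSum_succ_left hq, Finset.prod_range_succ _ (m + 1),
      Finset.prod_range_succ (fun k => 1 - q * q ^ k) m]
    linear_combination (1 - z * q ^ (m + 1)) * h1 - q ^ (m + 1) * (1 - z) * h2 +
      q ^ (m + 1) * poleSum q m 0 (z * q) * h3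

theorem poleSum_mul_prod (hq : q ≠ 0) (m n : ℕ) {z : K} (hz : z ≠ 0)
    (hzq : ∀ j : ℤ, 1 - z * q ^ j ≠ 0) :
    poleSum q m n z * ((∏ k ∈ Finset.range (m + 1), (1 - z * q ^ k)) *
        ∏ k ∈ Finset.range n, (1 - q / z * q ^ k)) =
      ∏ k ∈ Finset.range (m + n), (1 - q * q ^ k) := by
  induction n generalizing z with
  | zero => simpa using poleSum_zero_right_mul_prod hq m hzq
  | succ n ih =>
    obtain ⟨u, rfl⟩ : ∃ u, z = u * q := ⟨z / q, (div_mul_cancel₀ z hq).symm⟩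
    have hu : u ≠ 0 := left_ne_zero_of_mul hz
    have h1 := ih hz hzq
    have h2 := ih hu fun j => by
      have := hzq (j - 1)
      rwa [mul_assoc, ← zpow_one_add₀ hq, add_sub_cancel] at this
    have h3 := one_sub_mul_prod (q := q) u⁻¹ n
    have h4 := one_sub_mul_prod (q := q) u (m + 1)
    have huq : q / (u * q) = u⁻¹ := by field_simp
    rw [huq] at h1 ⊢
    rw [div_eq_inv_mul] at h2
    rw [poleSum_succ_right hq, mul_div_cancel_right₀ _ hq, ← add_assoc,
      Finset.prod_range_succ _ n, Finset.prod_range_succ (fun k => 1 - q * q ^ k) (m + n)]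
    set A := ∏ k ∈ Finset.range (m + 1), (1 - u * q * q ^ k)
    set B := ∏ k ∈ Finset.range n, (1 - u⁻¹ * q * q ^ k)
    linear_combination (1 - u⁻¹ * q ^ n) * h1 + q ^ n * u⁻¹ * (1 - u * q ^ (m + 1)) * h2 +
      q ^ n * poleSum q m n u * (A * h3 + u⁻¹ * B * h4 + A * B * inv_mul_cancel₀ hu) -
      q ^ n * q ^ (m + 1) * (∏ k ∈ Finset.range (m + n), (1 - q * q ^ k)) * inv_mul_cancel₀ hu

end PartialFractions

section RingHom

variable {K : Type*} [Field K] (f : ℤ⟦X⟧ →+* K)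

theorem map_inverse {u : ℤ⟦X⟧} (hu : IsUnit u) : f (Ring.inverse u) = (f u)⁻¹ := by
  apply eq_inv_of_mul_eq_one_left
  rw [← map_mul, Ring.inverse_mul_cancel _ hu, map_one]

theorem map_quot (g : ℤ⟦X⟧) {u : ℤ⟦X⟧} (hu : IsUnit u) : f (quot g u) = f g / f u := by
  rw [quot, map_mul, map_inverse f hu, div_eq_mul_inv]

theorem one_sub_map_X_pow_ne_zero {n : ℕ} (hn : n ≠ 0) : 1 - f X ^ n ≠ 0 := by
  have := ((isUnit_one_sub_X_pow hn).map f).ne_zero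
  rwa [map_sub, map_one, map_pow] at this

theorem one_sub_map_X_zpow_ne_zero {k : ℤ} (hk : k ≠ 0) : 1 - f X ^ k ≠ 0 := by
  have h := one_sub_map_X_pow_ne_zero f (Int.natAbs_ne_zero.mpr hk)
  rcases Int.natAbs_eq k with hk' | hk' <;> rw [hk']
  · rwa [zpow_natCast]
  · rw [zpow_neg, zpow_natCast, sub_ne_zero, ne_comm, inv_ne_one, ne_comm]
    exact sub_ne_zero.mp h

theorem map_X_ne_zero {g : ℤ⟦X⟧ →+* K} (hg : Function.Injective g) : g X ≠ 0 :=
  (map_ne_zero_iff g hg).mpr X_ne_zero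

/-- The expansion of `1 / (1 - q ^ (2 s + 1))` as a power series, for any integer `s`. -/
noncomputable def oddGeom : ℤ → ℤ⟦X⟧
  | (r : ℕ) => Ring.inverse (1 - X ^ (2 * r + 1))
  | Int.negSucc r => -(X ^ (2 * r + 1) * Ring.inverse (1 - X ^ (2 * r + 1)))

theorem oddGeom_natCast (r : ℕ) : oddGeom r = Ring.inverse (1 - X ^ (2 * r + 1)) := rfl

theorem oddGeom_negSucc (r : ℕ) : oddGeom (Int.negSucc r) = -(X ^ (2 * r + 1) * oddGeom r) := rfl

theorem map_oddGeom (hX : f X ≠ 0) (s : ℤ) : f (oddGeom s) = (1 - f X ^ (2 * s + 1))⁻¹ := by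
  have hu (r : ℕ) : IsUnit (1 - (X : ℤ⟦X⟧) ^ (2 * r + 1)) := isUnit_one_sub_X_pow (by lia)
  cases s with
  | ofNat r =>
    rw [Int.ofNat_eq_natCast, oddGeom_natCast, map_inverse f (hu r), map_sub, map_one, map_pow]
    norm_cast
  | negSucc r =>
    have h := one_sub_map_X_pow_ne_zero f (n := 2 * r + 1) (by lia)
    have h' : f X ^ (2 * r + 1) - 1 ≠ 0 := by rwa [← neg_ne_zero, neg_sub]
    rw [oddGeom_negSucc, oddGeom_natCast, map_neg, map_mul, map_inverse f (hu r), map_sub, map_one,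
      map_pow, show 2 * Int.negSucc r + 1 = -((2 * r + 1 : ℕ) : ℤ) by lia, zpow_neg, zpow_natCast]
    field_simp
    ring

end RingHom

theorem qPoch_sq_mul_sum_gaussBinom (n : ℕ) :
    (∑ i ∈ Finset.range (n + (n + 1) + 1), gaussBinom (X ^ 2) (n + (n + 1)) i *
        (thetaTerm (-X ^ 2) (-1) (i - (n + 1 : ℕ)) * oddGeom (i - (n + 1 : ℕ)))) *
      qPoch X (X ^ 2) (n + 1) ^ 2 = qPoch (X ^ 2) (X ^ 2) (n + (n + 1)) := by
  have hinj := IsFractionRing.injective ℤ⟦X⟧ (FractionRing ℤ⟦X⟧)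
  apply hinj
  set ι := algebraMap ℤ⟦X⟧ (FractionRing ℤ⟦X⟧)
  have hX : ι X ≠ 0 := map_X_ne_zero hinj
  have hpow (j : ℤ) : ι X * (ι X ^ 2) ^ j = ι X ^ (2 * j + 1) := by
    rw [zpow_add_one₀ hX, zpow_mul, mul_comm]
    norm_cast
  have h := poleSum_mul_prod (pow_ne_zero 2 hX) n (n + 1) hX fun j => by
    rw [hpow]
    exact one_sub_map_X_zpow_ne_zero ι (by lia)
  simp only [poleSum, hpow] at h
  simpa only [map_mul, map_sum, map_gaussBinom, map_thetaTerm, map_oddGeom ι hX, qPoch, map_prod,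
    map_sub, map_one, map_pow, map_neg, sq (ι X), mul_div_cancel_right₀ _ hX, div_eq_mul_inv,
    sq (∏ _ ∈ _, _)] using h

theorem decays_thetaTerm_mul_oddGeom :
    Decays fun j : ℤ => thetaTerm (-X ^ 2 : ℤ⟦X⟧) (-1) j * oddGeom j :=
  (decays_thetaTerm (by simp [pow_succ])).of_dvd fun _ => Dvd.intro _ rfl

theorem tsum_thetaTerm_mul_oddGeom :
    ∑' j, thetaTerm (-X ^ 2) (-1) j * oddGeom j = psi ^ 2 := by
  have hX : (X : ℤ⟦X⟧) ∣ X ^ 2 := dvd_pow_self X two_ne_zero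
  have hlim := (tendsto_sum_gaussBinom hX decays_thetaTerm_mul_oddGeom).mul
    (((tendsto_qPoch X hX).comp (tendsto_add_atTop_nat 1)).pow 2)
  have hnat : Tendsto (fun n : ℕ => n + (n + 1)) atTop atTop :=
    tendsto_atTop_mono (fun n => Nat.le_add_right n _) tendsto_id
  have hprod := tendsto_nhds_unique hlim ((((tendsto_qPoch (X ^ 2) hX).comp hnat).mul_const
    (qPochInf (X ^ 2) (X ^ 2))).congr fun n => by
      simp only [Function.comp_apply, ← qPoch_sq_mul_sum_gaussBinom]
      ring)
  rw [← E] at hprod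
  refine mul_right_cancel₀ ((isUnit_E one_pos).pow 2).ne_zero ?_
  rw [← mul_pow psi, psi_mul_E_one, E_one_eq]
  linear_combination E 2 ^ 2 * hprod

/-- The finite product `(q ^ 2; q ^ 2)_n`. -/
noncomputable abbrev evenPoch (n : ℕ) : ℤ⟦X⟧ := qPoch (X ^ 2) (X ^ 2) n

theorem isUnit_evenPoch (n : ℕ) : IsUnit (evenPoch n) :=
  isUnit_qPoch_of_X_dvd (dvd_pow_self X two_ne_zero) _ _

theorem evenPoch_succ (n : ℕ) : evenPoch (n + 1) = evenPoch n * (1 - X ^ (2 * n + 2)) := by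
  rw [evenPoch, qPoch_succ]
  ring

/-- The sequence `(-1) ^ r q ^ (r (r + 1)) (1 + q ^ (2 r + 1)) / (1 - q ^ (2 r + 1))`, which forms
with `1 / (q; q ^ 2)_{n+1} ^ 2` a Bailey pair relative to `q ^ 2` in base `q ^ 2`
(up to a factor `1 - q ^ 2`). -/
noncomputable def baileyAlpha (r : ℕ) : ℤ⟦X⟧ :=
  (-1) ^ r * X ^ (r * (r + 1)) * (1 + X ^ (2 * r + 1)) * oddGeom r

theorem neg_one_pow_tri_add_tri (R : Type*) [CommRing R] (j : ℤ) :
    (-1 : R) ^ (tri j + tri (j - 1)) = (-1) ^ j.natAbs := by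
  refine neg_one_pow_congr ?_
  have h1 := two_mul_tri j
  have h2 := tri_eq j
  have h3 : ((tri j + tri (j - 1) : ℕ) : ℤ) = j * j := by push_cast; linarith
  rw [← Int.even_coe_nat, h3, Int.even_mul, or_self, Int.natAbs_even]

theorem thetaTerm_neg_neg {R : Type*} [CommRing R] (a b : R) (j : ℤ) :
    thetaTerm (-a) (-b) j = (-1) ^ j.natAbs * thetaTerm a b j := by
  rw [← neg_one_pow_tri_add_tri, thetaTerm, thetaTerm, neg_pow, neg_pow b]
  ring

theorem thetaTerm_neg_X_sq_neg_one_natCast (r : ℕ) :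
    thetaTerm (-X ^ 2 : ℤ⟦X⟧) (-1) r = (-1) ^ r * X ^ (r * (r + 1)) := by
  rw [thetaTerm_neg_neg, Int.natAbs_natCast, thetaTerm, one_pow, mul_one, ← pow_mul]
  congr 2
  exact_mod_cast two_mul_tri r

theorem thetaTerm_neg_X_sq_neg_one_negSucc (r : ℕ) :
    thetaTerm (-X ^ 2 : ℤ⟦X⟧) (-1) (Int.negSucc r) = -((-1) ^ r * X ^ (r * (r + 1))) := by
  have habs : (-((r : ℤ) + 1)).natAbs = r + 1 := by lia
  rw [← thetaTerm_neg_X_sq_neg_one_natCast, thetaTerm_neg_neg, thetaTerm_neg_neg, thetaTerm,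
    thetaTerm, Int.negSucc_eq, habs, tri_neg, add_sub_cancel_right, Int.natAbs_natCast, pow_succ]
  ring

theorem gaussBinom_eq_quot (i k : ℕ) : gaussBinom (X ^ 2) (i + k) i =
    quot (evenPoch (i + k)) (evenPoch i * evenPoch k) := by
  have hu := (isUnit_evenPoch i).mul (isUnit_evenPoch k)
  rw [← hu.mul_left_inj, quot_mul_cancel _ hu, gaussBinom_mul_qPoch]

theorem gaussBinom_mul_add_gaussBinom_mul (r k : ℕ) :
    gaussBinom (X ^ 2) (r + k + (r + k + 1)) k *
        (thetaTerm (-X ^ 2) (-1) (Int.negSucc r) * oddGeom (Int.negSucc r)) +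
      gaussBinom (X ^ 2) (r + k + (r + k + 1)) (r + k + 1 + r) *
        (thetaTerm (-X ^ 2) (-1) r * oddGeom r) =
    evenPoch (r + k + (r + k + 1)) *
      quot (baileyAlpha r) (evenPoch k * evenPoch (r + k + r + 1)) := by
  rw [thetaTerm_neg_X_sq_neg_one_natCast, thetaTerm_neg_X_sq_neg_one_negSucc, oddGeom_negSucc,
    show r + k + (r + k + 1) = k + (r + k + r + 1) by ring, gaussBinom_eq_quot,
    show r + k + 1 + r = r + k + r + 1 by ring, add_comm k, gaussBinom_eq_quot,
    mul_comm (evenPoch k), quot, quot, baileyAlpha]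
  ring

theorem bailey_pair (n : ℕ) :
    (∑ r ∈ Finset.range (n + 1), quot (baileyAlpha r) (evenPoch (n - r) * evenPoch (n + r + 1))) *
      qPoch X (X ^ 2) (n + 1) ^ 2 = 1 := by
  refine mul_left_cancel₀ (isUnit_evenPoch (n + (n + 1))).ne_zero ?_
  refine Eq.trans ?_ ((qPoch_sq_mul_sum_gaussBinom n).trans (mul_one _).symm)
  rw [← mul_assoc]
  congr 1
  conv_rhs => rw [add_right_comm n (n + 1), Finset.sum_range_add, ← Finset.sum_range_reflect]
  rw [Finset.mul_sum, ← Finset.sum_add_distrib]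
  refine (Finset.sum_congr rfl fun r hr => ?_).symm
  obtain ⟨k, rfl⟩ := Nat.exists_eq_add_of_le (Finset.mem_range_succ_iff.mp hr)
  rw [show r + k - r = k by lia, show r + k + 1 - 1 - r = k by lia,
    show ((k : ℕ) : ℤ) - (r + k + 1 : ℕ) = Int.negSucc r by lia,
    show ((r + k + 1 + r : ℕ) : ℤ) - (r + k + 1 : ℕ) = r by lia]
  exact gaussBinom_mul_add_gaussBinom_mul r k

section Euler

variable {z q : ℤ⟦X⟧}

theorem decays_quot_qPoch (hz : X ∣ z) : Decays fun s => quot (z ^ s) (qPoch q q s) :=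
  decays_of_X_pow_dvd fun s => (pow_dvd_pow_of_dvd hz s).mul_right _

theorem quot_zero_qPoch_zero : quot (z ^ 0) (qPoch q q 0) = 1 := by
  rw [quot, qPoch_zero, pow_zero, Ring.inverse_one, mul_one]

theorem tsum_quot_qPoch_mul (hz : X ∣ z) (hq : X ∣ q) :
    ∑' s, quot ((z * q) ^ s) (qPoch q q s) = (1 - z) * ∑' s, quot (z ^ s) (qPoch q q s) := by
  have hsum := (decays_quot_qPoch (q := q) hz).summable
  have hsum' := (decays_quot_qPoch (q := q) (hz.mul_right q)).summable
  have hstep (s : ℕ) : quot (z ^ (s + 1)) (qPoch q q (s + 1)) -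
      quot ((z * q) ^ (s + 1)) (qPoch q q (s + 1)) = z * quot (z ^ s) (qPoch q q s) := by
    have hu := isUnit_qPoch_of_X_dvd hq q s
    have hu' := isUnit_qPoch_of_X_dvd hq q (s + 1)
    rw [← hu'.mul_left_inj, sub_mul, quot_mul_cancel _ hu', quot_mul_cancel _ hu', qPoch_succ]
    linear_combination -z * (1 - q * q ^ s) * quot_mul_cancel (z ^ s) hu
  have h : ∑' s, quot (z ^ s) (qPoch q q s) - ∑' s, quot ((z * q) ^ s) (qPoch q q s) =
      z * ∑' s, quot (z ^ s) (qPoch q q s) := by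
    rw [← hsum.tsum_sub hsum', (hsum.sub hsum').tsum_eq_zero_add, quot_zero_qPoch_zero,
      quot_zero_qPoch_zero, sub_self, zero_add, ← hsum.tsum_mul_left]
    exact tsum_congr hstep
  linear_combination -h

theorem qPochInf_mul_tsum_quot_qPoch (hz : X ∣ z) (hq : X ∣ q) :
    qPochInf z q * ∑' s, quot (z ^ s) (qPoch q q s) = 1 := by
  have hiter (k : ℕ) : ∑' s, quot ((z * q ^ k) ^ s) (qPoch q q s) =
      qPoch z q k * ∑' s, quot (z ^ s) (qPoch q q s) := by
    induction k with
    | zero => rw [pow_zero, mul_one, qPoch_zero, one_mul]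
    | succ k ih =>
      rw [pow_succ, ← mul_assoc, tsum_quot_qPoch_mul (hz.mul_right _) hq, ih, qPoch_succ]
      ring
  have hdvd (k : ℕ) : X ^ k ∣ ∑' s, quot ((z * q ^ k) ^ s) (qPoch q q s) - 1 := by
    rw [(decays_quot_qPoch (hz.mul_right (q ^ k))).summable.tsum_eq_zero_add, quot_zero_qPoch_zero,
      add_sub_cancel_left]
    refine X_pow_dvd_tsum fun s => Dvd.dvd.mul_right ?_ _
    exact dvd_pow ((pow_dvd_pow_of_dvd hq k).mul_left z) s.succ_ne_zero
  refine tendsto_nhds_unique ((tendsto_qPoch z hq).mul_const _) ?_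
  refine tendsto_of_eventually_X_pow_dvd fun n => ?_
  filter_upwards [eventually_ge_atTop n] with k hk
  rw [← hiter]
  exact (pow_dvd_pow X hk).trans (hdvd k)

end Euler

/-- The `s`-th term of the `q`-Gauss sum
`∑ (-q; q)_{N+2s} q ^ s / ((q ^ 2; q ^ 2)_s (q ^ 2; q ^ 2)_{s+N+1})`. -/
noncomputable def gaussTerm (N s : ℕ) : ℤ⟦X⟧ :=
  quot (qPoch (-X) X (N + 2 * s) * X ^ s) (evenPoch s * evenPoch (s + N + 1))

theorem X_pow_dvd_gaussTerm (N s : ℕ) : X ^ s ∣ gaussTerm N s :=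
  (Dvd.intro_left _ rfl).mul_right _

theorem summable_gaussTerm (N : ℕ) : Summable (gaussTerm N) :=
  (decays_of_X_pow_dvd (X_pow_dvd_gaussTerm N)).summable

/-- A primitive, with respect to `s`, of
`(1 + q ^ (N + 1)) * gaussTerm N s - (1 + q ^ (N + 2)) * gaussTerm (N + 1) s`. -/
noncomputable def gaussPrimitive (N s : ℕ) : ℤ⟦X⟧ :=
  -quot (X ^ (N + 1) * X ^ s * qPoch (-X) X (N + 2 * s) * (1 - X ^ (2 * s)))
    (evenPoch s * evenPoch (s + N + 1))

theorem X_pow_dvd_gaussPrimitive (N s : ℕ) : X ^ s ∣ gaussPrimitive N s :=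
  ((((Dvd.intro_left _ rfl).mul_right _).mul_right _).mul_right _).neg_right

theorem gaussPrimitive_zero (N : ℕ) : gaussPrimitive N 0 = 0 := by simp [gaussPrimitive, quot]

theorem gauss_telescope {K : Type*} [Field K] (p x y t : K) {u w : K} (hu : u ≠ 0) (hw : w ≠ 0)
    (hxy : 1 - x ^ 2 * y ^ 2 ≠ 0) (hxty : 1 - x ^ 2 * t ^ 2 * y ^ 2 ≠ 0) :
    (1 + t) * (p * y / (u * w)) - (1 + x * t) *
      (p * (1 + t * y ^ 2) * y / (u * (w * (1 - x ^ 2 * t ^ 2 * y ^ 2)))) =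
    -(t * (x * y) * (p * (1 + t * y ^ 2) * (1 + x * t * y ^ 2)) * (1 - x ^ 2 * y ^ 2) /
      ((u * (1 - x ^ 2 * y ^ 2)) * (w * (1 - x ^ 2 * t ^ 2 * y ^ 2)))) -
    -(t * y * p * (1 - y ^ 2) / (u * w)) := by
  generalize 1 - x ^ 2 * y ^ 2 = c at *
  generalize hd : 1 - x ^ 2 * t ^ 2 * y ^ 2 = d at *
  field_simp
  rw [← hd]
  ring

theorem gaussTerm_sub_eq_gaussPrimitive_sub (N s : ℕ) :
    (1 + X ^ (N + 1)) * gaussTerm N s - (1 + X ^ (N + 2)) * gaussTerm (N + 1) s =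
      gaussPrimitive N (s + 1) - gaussPrimitive N s := by
  apply IsFractionRing.injective ℤ⟦X⟧ (FractionRing ℤ⟦X⟧)
  set ι := algebraMap ℤ⟦X⟧ (FractionRing ℤ⟦X⟧)
  have hquot (f : ℤ⟦X⟧) (i j : ℕ) : ι (quot f (evenPoch i * evenPoch j)) =
      ι f / (ι (evenPoch i) * ι (evenPoch j)) := by
    rw [map_quot ι f ((isUnit_evenPoch i).mul (isUnit_evenPoch j)), map_mul]
  have h := gauss_telescope (ι (qPoch (-X) X (N + 2 * s))) (ι X) (ι X ^ s) (ι X ^ (N + 1))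
    ((isUnit_evenPoch s).map ι).ne_zero ((isUnit_evenPoch (s + N + 1)).map ι).ne_zero
    (by convert one_sub_map_X_pow_ne_zero ι (n := 2 * s + 2) (by lia) using 2; ring)
    (by convert one_sub_map_X_pow_ne_zero ι (n := 2 * (s + N + 1) + 2) (by lia) using 2; ring)
  simp only [gaussPrimitive, gaussTerm, map_sub, map_mul, map_neg, map_add, map_one, map_pow, hquot]
  rw [show N + 1 + 2 * s = N + 2 * s + 1 by ring,
    show N + 2 * (s + 1) = N + 2 * s + 1 + 1 by ring,
    show s + (N + 1) + 1 = s + N + 1 + 1 by ring, show s + 1 + N + 1 = s + N + 1 + 1 by ring,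
    evenPoch_succ (s + N + 1), evenPoch_succ s, qPoch_succ (-X) X (N + 2 * s + 1),
    qPoch_succ (-X) X (N + 2 * s)]
  simp only [map_sub, map_mul, map_neg, map_one, map_pow]
  convert h using 1 <;> ring

theorem one_add_mul_tsum_gaussTerm (N : ℕ) :
    (1 + X ^ (N + 1)) * ∑' s, gaussTerm N s = (1 + X) * ∑' s, gaussTerm 0 s := by
  induction N with
  | zero => rw [zero_add, pow_one]
  | succ N ih =>
    rw [← ih, eq_comm, ← sub_eq_zero, ← (summable_gaussTerm N).tsum_mul_left,
      ← (summable_gaussTerm (N + 1)).tsum_mul_left, ← ((summable_gaussTerm N).mul_left _).tsum_sub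
        ((summable_gaussTerm (N + 1)).mul_left _),
      tsum_congr (gaussTerm_sub_eq_gaussPrimitive_sub N)]
    exact tsum_telescope (gaussPrimitive_zero N) (X_pow_dvd_gaussPrimitive N)

theorem X_pow_dvd_gaussTerm_mul_sub (N s : ℕ) :
    X ^ N ∣ gaussTerm N s * E 2 - qPochInf (-X) X * quot (X ^ s) (evenPoch s) := by
  have hX : (X : ℤ⟦X⟧) ∣ X ^ 2 := dvd_pow_self X two_ne_zero
  have hu := isUnit_evenPoch s
  have hv := isUnit_evenPoch (s + N + 1)
  have hg : gaussTerm N s * (evenPoch s * evenPoch (s + N + 1)) =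
      qPoch (-X) X (N + 2 * s) * X ^ s := quot_mul_cancel _ (hu.mul hv)
  have hE : X ^ N ∣ E 2 - evenPoch (s + N + 1) :=
    (pow_dvd_pow X (by lia)).trans (X_pow_dvd_qPochInf_sub_qPoch (X ^ 2) hX (s + N + 1))
  have hP : X ^ N ∣ qPochInf (-X) X - qPoch (-X) X (N + 2 * s) :=
    (pow_dvd_pow X (by lia)).trans (X_pow_dvd_qPochInf_sub_qPoch (-X) (dvd_refl X) (N + 2 * s))
  rw [← (hu.mul hv).dvd_mul_right]
  have h : (gaussTerm N s * E 2 - qPochInf (-X) X * quot (X ^ s) (evenPoch s)) *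
      (evenPoch s * evenPoch (s + N + 1)) =
      X ^ s * (qPoch (-X) X (N + 2 * s) * (E 2 - evenPoch (s + N + 1)) -
        evenPoch (s + N + 1) * (qPochInf (-X) X - qPoch (-X) X (N + 2 * s))) := by
    linear_combination E 2 * hg -
      qPochInf (-X) X * evenPoch (s + N + 1) * quot_mul_cancel (X ^ s) hu
  rw [h]
  exact (dvd_sub (hE.mul_left _) (hP.mul_left _)).mul_left _

theorem one_add_X_mul_tsum_gaussTerm_zero_mul :
    (1 + X) * (∑' s, gaussTerm 0 s) * E 2 =
      qPochInf (-X) X * ∑' s, quot (X ^ s) (evenPoch s) := by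
  have hsum : Summable fun s => quot (X ^ s) (evenPoch s) :=
    (decays_quot_qPoch dvd_rfl).summable
  refine eq_of_forall_X_pow_dvd_sub fun N => ?_
  have hlim : X ^ N ∣ (∑' s, gaussTerm N s) * E 2 -
      qPochInf (-X) X * ∑' s, quot (X ^ s) (evenPoch s) := by
    rw [← (summable_gaussTerm N).tsum_mul_right, ← hsum.tsum_mul_left,
      ← ((summable_gaussTerm N).mul_right _).tsum_sub (hsum.mul_left _)]
    exact X_pow_dvd_tsum (X_pow_dvd_gaussTerm_mul_sub N)
  have h : (1 + X) * (∑' s, gaussTerm 0 s) * E 2 -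
      qPochInf (-X) X * ∑' s, quot (X ^ s) (evenPoch s) =
      X ^ N * (X * (∑' s, gaussTerm N s) * E 2) + ((∑' s, gaussTerm N s) * E 2 -
        qPochInf (-X) X * ∑' s, quot (X ^ s) (evenPoch s)) := by
    linear_combination -E 2 * one_add_mul_tsum_gaussTerm N
  rw [h]
  exact dvd_add (Dvd.intro _ rfl) hlim

theorem tsum_gaussTerm (N : ℕ) : (1 + X ^ (N + 1)) * (∑' s, gaussTerm N s) * E 1 ^ 2 = E 2 := by
  have heuler : qPochInf X (X ^ 2) * ∑' s, quot (X ^ s) (evenPoch s) = 1 :=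
    qPochInf_mul_tsum_quot_qPoch dvd_rfl (dvd_pow_self X two_ne_zero)
  rw [one_add_mul_tsum_gaussTerm]
  linear_combination E 1 * (1 + X) * (∑' s, gaussTerm 0 s) * E_one_eq +
    E 1 * qPochInf X (X ^ 2) * one_add_X_mul_tsum_gaussTerm_zero_mul +
    E 1 * qPochInf (-X) X * heuler + E_one_mul_qPochInf_neg

/-- The Appell–Lerch sum `∑ (-1) ^ r q ^ ((r + 1) ^ 2) / (1 - q ^ (2 r + 1))`. -/
noncomputable def lerchSum : ℤ⟦X⟧ :=
  ∑' r : ℕ, (-1) ^ r * X ^ ((r + 1) ^ 2) * oddGeom r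

theorem summable_lerchSum :
    Summable fun r : ℕ => (-1) ^ r * X ^ ((r + 1) ^ 2) * oddGeom r :=
  (decays_of_X_pow_dvd fun r =>
    ((pow_dvd_pow X (by nlinarith)).mul_left _).mul_right _).summable

theorem phiTerm_eq_sum_antidiagonal (n : ℕ) :
    phiTerm n = ∑ p ∈ antidiagonal n,
      X ^ (p.1 + 1) * baileyAlpha p.1 * gaussTerm (2 * p.1) p.2 := by
  have hu : IsUnit (qPoch X (X ^ 2) (n + 1) ^ 2) := (isUnit_qPoch (n + 1)).pow 2
  have h : ∑ p ∈ antidiagonal n, X ^ (p.1 + 1) * baileyAlpha p.1 * gaussTerm (2 * p.1) p.2 =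
      qPoch (-X) X (2 * n) * X ^ (n + 1) * ∑ r ∈ Finset.range (n + 1),
        quot (baileyAlpha r) (evenPoch (n - r) * evenPoch (n + r + 1)) := by
    rw [Finset.Nat.sum_antidiagonal_eq_sum_range_succ_mk, Finset.mul_sum]
    refine Finset.sum_congr rfl fun r hr => ?_
    obtain ⟨k, rfl⟩ := Nat.exists_eq_add_of_le (Finset.mem_range_succ_iff.mp hr)
    rw [gaussTerm, quot, quot, show r + k - r = k by lia, show 2 * r + 2 * k = 2 * (r + k) by ring,
      show k + 2 * r + 1 = r + k + r + 1 by ring]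
    ring
  rw [h, ← hu.mul_left_inj, phiTerm, quot_mul_cancel _ hu]
  linear_combination -(qPoch (-X) X (2 * n) * X ^ (n + 1) * bailey_pair n)

theorem decays_mul_gaussTerm :
    Decays fun p : ℕ × ℕ => X ^ (p.1 + 1) * baileyAlpha p.1 * gaussTerm (2 * p.1) p.2 :=
  have hX : Decays fun n : ℕ => (X : ℤ⟦X⟧) ^ n := decays_of_X_pow_dvd fun _ => dvd_rfl
  (hX.mul hX).of_dvd fun p =>
    mul_dvd_mul ((pow_dvd_pow X (Nat.le_succ p.1)).mul_right _) (X_pow_dvd_gaussTerm _ _)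

theorem phi_eq_tsum :
    phi = ∑' r, X ^ (r + 1) * baileyAlpha r * ∑' s, gaussTerm (2 * r) s := by
  calc phi = ∑' n, ∑ p ∈ antidiagonal n,
        X ^ (p.1 + 1) * baileyAlpha p.1 * gaussTerm (2 * p.1) p.2 :=
      tsum_congr phiTerm_eq_sum_antidiagonal
    _ = ∑' p : ℕ × ℕ, X ^ (p.1 + 1) * baileyAlpha p.1 * gaussTerm (2 * p.1) p.2 :=
      decays_mul_gaussTerm.tsum_antidiagonal
    _ = ∑' r, ∑' s, X ^ (r + 1) * baileyAlpha r * gaussTerm (2 * r) s :=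
      decays_mul_gaussTerm.tsum_prod
    _ = _ := tsum_congr fun r => (summable_gaussTerm (2 * r)).tsum_mul_left _

theorem phi_mul_E_one_sq : phi * E 1 ^ 2 = E 2 * lerchSum := by
  have hsum : Summable fun r => X ^ (r + 1) * baileyAlpha r * ∑' s, gaussTerm (2 * r) s :=
    (decays_of_X_pow_dvd fun r =>
      ((pow_dvd_pow X r.le_succ).mul_right _).mul_right _).summable
  rw [phi_eq_tsum, ← hsum.tsum_mul_right, lerchSum, ← summable_lerchSum.tsum_mul_left]
  refine tsum_congr fun r => ?_
  rw [← tsum_gaussTerm (2 * r), baileyAlpha]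
  ring

/-! ### The odd part of `φ(q)` -/

/-- The shifted bilateral Lerch series `∑_{s ∈ ℤ} t_{s-w} / (1 - q ^ (2 s + 1))`, where `t_j` is
the term `(-1) ^ j q ^ (j (j + 1))` of the vanishing series `f(-q ^ 2, -1)`. -/
noncomputable def shiftedLerch (w : ℤ) : ℤ⟦X⟧ :=
  ∑' s : ℤ, thetaTerm (-X ^ 2) (-1) (s - w) * oddGeom s

theorem decays_thetaTerm_neg_X_sq_neg_one : Decays (thetaTerm (-X ^ 2 : ℤ⟦X⟧) (-1)) :=
  decays_thetaTerm (by simp [pow_succ])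

theorem decays_shiftedLerch (w : ℤ) :
    Decays fun s : ℤ => thetaTerm (-X ^ 2 : ℤ⟦X⟧) (-1) (s - w) * oddGeom s :=
  (decays_thetaTerm_neg_X_sq_neg_one.comp_injective (sub_left_injective (b := w))).of_dvd
    fun _ => Dvd.intro _ rfl

theorem X_pow_mul_thetaTerm_mul_oddGeom {w : ℤ} {m n : ℕ} (h : (n : ℤ) = m + (2 * w + 1)) (s : ℤ) :
    X ^ n * (thetaTerm (-X ^ 2) (-1) (s - w) * oddGeom s) =
      X ^ m * (thetaTerm (-X ^ 2) (-1) (s - (w + 1)) -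
        thetaTerm (-X ^ 2) (-1) (s - (w + 1)) * oddGeom s) := by
  have hinj := IsFractionRing.injective ℤ⟦X⟧ (FractionRing ℤ⟦X⟧)
  apply hinj
  set ι := algebraMap ℤ⟦X⟧ (FractionRing ℤ⟦X⟧)
  have hX : ι X ≠ 0 := map_X_ne_zero hinj
  have hs := one_sub_map_X_zpow_ne_zero ι (k := 2 * s + 1) (by lia)
  have hpow : ι X ^ n * (ι X ^ 2) ^ (s - w) = ι X ^ m * ι X ^ (2 * s + 1) := by
    rw [← zpow_natCast (ι X) n, ← zpow_natCast (ι X) m, ← zpow_natCast (ι X) 2, ← zpow_mul,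
      ← zpow_add₀ hX, ← zpow_add₀ hX, h]
    congr 1
    push_cast
    ring
  simp only [map_mul, map_sub, map_pow, map_thetaTerm, map_neg, map_one, map_oddGeom ι hX]
  rw [thetaTerm_sub_one (pow_ne_zero 2 hX) (s - w), sub_sub]
  field_simp
  linear_combination -thetaTerm (-ι X ^ 2) (-1) (s - (w + 1)) * hpow

theorem X_pow_mul_shiftedLerch {w : ℤ} {m n : ℕ} (h : (n : ℤ) = m + (2 * w + 1)) :
    X ^ n * shiftedLerch w = -(X ^ m * shiftedLerch (w + 1)) := by
  have hT : Summable fun s : ℤ => thetaTerm (-X ^ 2 : ℤ⟦X⟧) (-1) (s - (w + 1)) :=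
    (decays_thetaTerm_neg_X_sq_neg_one.comp_injective sub_left_injective).summable
  have hF := (decays_shiftedLerch (w + 1)).summable
  have hzero : ∑' s : ℤ, thetaTerm (-X ^ 2 : ℤ⟦X⟧) (-1) (s - (w + 1)) = 0 := by
    refine ((Equiv.subRight (w + 1)).tsum_eq (thetaTerm (-X ^ 2) (-1))).trans ?_
    rw [← theta, theta_comm, theta_neg_one (dvd_pow_self X two_ne_zero).neg_right]
  rw [shiftedLerch, ← (decays_shiftedLerch w).summable.tsum_mul_left,
    tsum_congr (X_pow_mul_thetaTerm_mul_oddGeom h), (hT.sub hF).tsum_mul_left, hT.tsum_sub hF,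
    hzero, ← shiftedLerch, zero_sub, mul_neg]

theorem X_pow_mul_thetaTerm_neg_X_neg_X {w : ℤ} {m n : ℕ} (h : (n : ℤ) = m + (2 * w + 1)) :
    X ^ n * thetaTerm (-X : ℤ⟦X⟧) (-X) w = -(X ^ m * thetaTerm (-X) (-X) (w + 1)) := by
  have htri : n + (tri w + tri (w - 1)) = m + (tri (w + 1) + tri w) := by
    have h1 := tri_eq w
    have h2 := tri_eq (w + 1)
    rw [add_sub_cancel_right] at h2
    lia
  have hsign : (-1 : ℤ⟦X⟧) ^ (w + 1).natAbs = -(-1) ^ w.natAbs := by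
    rw [← neg_one_mul (_ ^ _), ← pow_succ']
    exact neg_one_pow_congr (by grind)
  rw [thetaTerm_neg_neg, thetaTerm_neg_neg, thetaTerm, thetaTerm, hsign, add_sub_cancel_right,
    ← pow_add, ← pow_add, mul_left_comm, ← pow_add, htri]
  ring

theorem shiftedLerch_eq (w : ℤ) : shiftedLerch w = thetaTerm (-X) (-X) w * psi ^ 2 := by
  induction w with
  | zero =>
    rw [← tsum_thetaTerm_mul_oddGeom, shiftedLerch]
    simp [thetaTerm, tri]
  | succ w ih =>
    have h : ((2 * w + 1 : ℕ) : ℤ) = (0 : ℕ) + (2 * w + 1) := by simp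
    have hT := X_pow_mul_thetaTerm_neg_X_neg_X h
    linear_combination X_pow_mul_shiftedLerch h - X ^ (2 * w + 1) * ih - psi ^ 2 * hT
  | pred w ih =>
    have h : ((0 : ℕ) : ℤ) = (2 * w + 1 : ℕ) + (2 * (-w - 1) + 1) := by push_cast; ring
    have hT := X_pow_mul_thetaTerm_neg_X_neg_X h
    have hF := X_pow_mul_shiftedLerch h
    rw [sub_add_cancel, pow_zero, one_mul] at hT hF
    rw [hF, ih, hT]
    ring

theorem oddGeom_natCast_eq_mul_expand (r : ℕ) :
    oddGeom r = (1 + X ^ (2 * r + 1)) * expand 2 two_ne_zero (oddGeom r) := by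
  have hu := isUnit_one_sub_X_pow (n := 2 * r + 1) (by lia)
  have h1 : oddGeom r * (1 - X ^ (2 * r + 1)) = 1 := Ring.inverse_mul_cancel _ hu
  have h2 := congrArg (expand 2 two_ne_zero) h1
  simp only [map_mul, map_sub, map_pow, map_one, expand_X] at h2
  linear_combination (1 + X ^ (2 * r + 1)) * expand 2 two_ne_zero (oddGeom r) * h1 - oddGeom r * h2

theorem thetaTerm_X_X (j : ℤ) : thetaTerm (X : ℤ⟦X⟧) X j = X ^ j.natAbs ^ 2 := by
  have h : tri j + tri (j - 1) = j.natAbs ^ 2 := by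
    have h1 := two_mul_tri j
    have h2 := tri_eq j
    zify
    rw [sq_abs]
    linarith
  rw [thetaTerm, ← pow_add, h]

theorem thetaTerm_neg_X_neg_X (j : ℤ) :
    thetaTerm (-X : ℤ⟦X⟧) (-X) j = (-1) ^ j.natAbs * X ^ j.natAbs ^ 2 := by
  rw [thetaTerm_neg_neg, thetaTerm_X_X]

theorem decays_thetaTerm_add_one_mul_expand :
    Decays fun s : ℤ => thetaTerm (-X : ℤ⟦X⟧) (-X) (s + 1) * expand 2 two_ne_zero (oddGeom s) :=
  ((decays_thetaTerm (by simp)).comp_injective (add_left_injective (1 : ℤ))).of_dvd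
    fun _ => Dvd.intro _ rfl

theorem lerchSum_eq_tsum :
    lerchSum =
      -∑' s : ℤ, thetaTerm (-X) (-X) (s + 1) * expand 2 two_ne_zero (oddGeom s) := by
  have hsum := decays_thetaTerm_add_one_mul_expand.summable
  rw [← tsum_neg, ← hsum.neg.hasSum.nat_add_neg_add_one.tsum_eq, lerchSum]
  refine tsum_congr fun r => ?_
  have hneg : (-((r : ℤ) + 1)) = Int.negSucc r := by lia
  rw [hneg, oddGeom_negSucc, thetaTerm_neg_X_neg_X, thetaTerm_neg_X_neg_X,
    show ((r : ℤ) + 1).natAbs = r + 1 by lia, show (Int.negSucc r + 1).natAbs = r by lia]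
  simp only [map_neg, map_mul, map_pow, expand_X]
  conv_lhs => rw [oddGeom_natCast_eq_mul_expand]
  ring

theorem neg_one_pow_natAbs_add_one (s u : ℤ) :
    (-1 : ℤ⟦X⟧) ^ (s + 1).natAbs = -((-1) ^ u.natAbs * (-1) ^ (s - u).natAbs) := by
  rw [← neg_one_mul (_ * _), ← pow_add, ← pow_succ']
  exact neg_one_pow_congr (by grind)

theorem thetaTerm_add_one_mul_thetaTerm_sub_two_mul (s u : ℤ) :
    thetaTerm (-X : ℤ⟦X⟧) (-X) (s + 1) * thetaTerm X X (s - 2 * u) =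
      expand 2 two_ne_zero (-(thetaTerm (-X ^ 2) (-1) u * thetaTerm (-X ^ 2) (-1) (s - u))) *
        X ^ 1 := by
  have htri : tri (s + 1) + tri s + (tri (s - 2 * u) + tri (s - 2 * u - 1)) =
      2 * (2 * tri u) + 2 * (2 * tri (s - u)) + 1 := by
    zify
    linarith [two_mul_tri (s + 1), two_mul_tri s, two_mul_tri (s - 2 * u),
      two_mul_tri (s - 2 * u - 1), two_mul_tri u, two_mul_tri (s - u)]
  simp only [map_neg, map_mul, map_thetaTerm, map_pow, expand_X, map_one, thetaTerm_neg_neg]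
  simp only [thetaTerm, neg_one_pow_natAbs_add_one s u, one_pow, add_sub_cancel_right]
  linear_combination -((-1 : ℤ⟦X⟧) ^ u.natAbs * (-1) ^ (s - u).natAbs) *
    congrArg (X ^ · : ℕ → ℤ⟦X⟧) htri

theorem sect_thetaTerm_mul_thetaTerm_sub_two_mul (f : ℤ⟦X⟧) (s u : ℤ) :
    sect 2 1 (thetaTerm (-X) (-X) (s + 1) * expand 2 two_ne_zero f * thetaTerm X X (s - 2 * u)) =
      -(thetaTerm (-X ^ 2) (-1) u * (thetaTerm (-X ^ 2) (-1) (s - u) * f)) := by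
  rw [mul_right_comm, thetaTerm_add_one_mul_thetaTerm_sub_two_mul, mul_right_comm, ← map_mul,
    sect_expand_mul_X_pow_self two_ne_zero one_lt_two]
  ring

theorem sect_thetaTerm_mul_thetaTerm_of_odd (f : ℤ⟦X⟧) {s n : ℤ} (h : Odd (s - n)) :
    sect 2 1 (thetaTerm (-X) (-X) (s + 1) * expand 2 two_ne_zero f * thetaTerm X X n) = 0 := by
  have hexp : (-1) ^ (s + 1).natAbs * X ^ (s + 1).natAbs ^ 2 * expand 2 two_ne_zero f *
      X ^ n.natAbs ^ 2 = expand 2 two_ne_zero ((-1) ^ (s + 1).natAbs * f) *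
        X ^ ((s + 1).natAbs ^ 2 + n.natAbs ^ 2) := by
    rw [map_mul, map_pow, map_neg, map_one]
    ring
  have heven : Even ((s + 1).natAbs ^ 2 + n.natAbs ^ 2) := by
    rw [Nat.even_add, Nat.even_pow' two_ne_zero, Nat.even_pow' two_ne_zero, Int.natAbs_even,
      Int.natAbs_even]
    grind
  rw [thetaTerm_neg_X_neg_X, thetaTerm_X_X, hexp,
    sect_expand_mul_X_pow_of_ne two_ne_zero one_lt_two (by simp [Nat.even_iff.mp heven])]

theorem decays_mul_shiftedLerch_term :
    Decays fun p : ℤ × ℤ => thetaTerm (-X ^ 2 : ℤ⟦X⟧) (-1) p.1 *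
      (thetaTerm (-X ^ 2) (-1) (p.2 - p.1) * oddGeom p.2) := by
  have he : Function.Injective fun p : ℤ × ℤ => (p.1, p.2 - p.1) := by
    rintro ⟨u, s⟩ ⟨u', s'⟩ h
    simp only [Prod.mk.injEq] at h ⊢
    lia
  have hT := decays_thetaTerm_neg_X_sq_neg_one
  exact ((hT.mul hT).comp_injective he).of_dvd fun p => by
    rw [← mul_assoc]
    exact Dvd.intro _ rfl

theorem sect_lerchSum_mul_theta :
    sect 2 1 (lerchSum * theta X X) = ∑' u, thetaTerm (-X ^ 2) (-1) u * shiftedLerch u := by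
  have hX : Decays (thetaTerm (X : ℤ⟦X⟧) X) := decays_thetaTerm (by simp)
  have hdec := decays_thetaTerm_add_one_mul_expand.mul hX
  have he : Function.Injective fun p : ℤ × ℤ => (p.2, p.2 - 2 * p.1) := by
    rintro ⟨u, s⟩ ⟨u', s'⟩ h
    simp only [Prod.mk.injEq] at h ⊢
    lia
  rw [lerchSum_eq_tsum, neg_mul, theta, decays_thetaTerm_add_one_mul_expand.tsum_mul_tsum hX,
    map_neg, hdec.summable.map_tsum (sect 2 1) (continuous_sect 2 1), ← he.tsum_eq, ← tsum_neg]
  · simp only [sect_thetaTerm_mul_thetaTerm_sub_two_mul, neg_neg]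
    rw [decays_mul_shiftedLerch_term.tsum_prod]
    refine tsum_congr fun u => ?_
    rw [shiftedLerch, ← (decays_shiftedLerch u).summable.tsum_mul_left]
  · rintro ⟨s, n⟩ hp
    rw [Function.mem_support] at hp
    obtain ⟨u, hu⟩ : Even (s - n) := by
      by_contra h
      exact hp (sect_thetaTerm_mul_thetaTerm_of_odd _ (Int.not_even_iff_odd.mp h))
    exact ⟨(u, s), by simp only [Prod.mk.injEq]; lia⟩

theorem tsum_thetaTerm_mul_shiftedLerch :
    ∑' u, thetaTerm (-X ^ 2) (-1) u * shiftedLerch u = psi ^ 3 := by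
  have hterm (u : ℤ) : thetaTerm (-X ^ 2) (-1) u * shiftedLerch u =
      thetaTerm (X ^ 3) X u * psi ^ 2 := by
    rw [shiftedLerch_eq, ← mul_assoc]
    congr 1
    simp only [thetaTerm]
    rw [mul_mul_mul_comm, ← mul_pow, ← mul_pow]
    congr 2 <;> ring
  have hdec : Decays (thetaTerm (X ^ 3 : ℤ⟦X⟧) X) := decays_thetaTerm (by simp)
  rw [tsum_congr hterm, hdec.summable.tsum_mul_right, ← theta, theta_comm, ← psi]
  ring

theorem phi_mul_theta_neg_X : phi * theta (-X) (-X) = lerchSum := by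
  refine mul_right_cancel₀ (isUnit_E two_pos).ne_zero ?_
  rw [mul_assoc, theta_neg_X_neg_X_mul_E_two, phi_mul_E_one_sq, mul_comm]

theorem theta_X_X_mul_theta_neg_X_neg_X :
    theta X X * theta (-X) (-X) = expand 2 two_ne_zero (theta (-X) (-X)) ^ 2 := by
  have h := theta_mul_theta_eq_add (a := X) (e := -1) (g := -1) dvd_rfl
  have h₁ : theta (-1 : ℤ⟦X⟧) (X ^ 4 * (-1) ^ 2 * -1) = 0 :=
    theta_neg_one (by simp [pow_succ])
  have h₂ : theta (-1 : ℤ⟦X⟧) (X ^ 4 * -1 * (-1) ^ 2) = 0 :=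
    theta_neg_one (by simp [pow_succ])
  rw [theta_comm _ (-1), theta_comm _ (-1), h₁, h₂, mul_zero, mul_zero, add_zero] at h
  rw [expand_theta (by simp), map_neg, expand_X, sq]
  convert h using 2 <;> ring_nf

theorem sect_two_one_phi_mul_theta_sq : sect 2 1 phi * theta (-X) (-X) ^ 2 = psi ^ 3 := by
  rw [mul_comm, ← sect_expand_mul two_ne_zero one_lt_two, map_pow,
    ← theta_X_X_mul_theta_neg_X_neg_X, ← tsum_thetaTerm_mul_shiftedLerch,
    ← sect_lerchSum_mul_theta, ← phi_mul_theta_neg_X]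
  congr 1
  ring

/-! ### Rogers–Ramanujan products -/

/-- The product `(q, q ^ 4; q ^ 5)_∞`, the reciprocal of the Rogers–Ramanujan function `G(q)`. -/
noncomputable def rrOne (q : ℤ⟦X⟧) : ℤ⟦X⟧ := qPochInf q (q ^ 5) * qPochInf (q ^ 4) (q ^ 5)

/-- The product `(q ^ 2, q ^ 3; q ^ 5)_∞`, the reciprocal of the Rogers–Ramanujan function
`H(q)`. -/
noncomputable def rrTwo (q : ℤ⟦X⟧) : ℤ⟦X⟧ := qPochInf (q ^ 2) (q ^ 5) * qPochInf (q ^ 3) (q ^ 5)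

section RogersRamanujan

variable {q : ℤ⟦X⟧} (hq : X ∣ q)
include hq

theorem isUnit_rrOne : IsUnit (rrOne q) :=
  have h {n : ℕ} (hn : n ≠ 0) : X ∣ q ^ n := dvd_pow hq hn
  (isUnit_qPochInf hq (h (by simp))).mul (isUnit_qPochInf (h (by simp)) (h (by simp)))

theorem isUnit_rrTwo : IsUnit (rrTwo q) :=
  have h {n : ℕ} (hn : n ≠ 0) : X ∣ q ^ n := dvd_pow hq hn
  (isUnit_qPochInf (h (by simp)) (h (by simp))).mul (isUnit_qPochInf (h (by simp)) (h (by simp)))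

theorem rrOne_mul_rrTwo_mul :
    rrOne q * rrTwo q * qPochInf (q ^ 5) (q ^ 5) = qPochInf q q := by
  rw [qPochInf_eq_prod q hq (d := 5) (by simp), rrOne, rrTwo]
  simp only [Finset.prod_range_succ, Finset.prod_range_zero, ← pow_succ', zero_add, pow_one,
    Nat.reduceAdd]
  ring

theorem theta_neg_pow_neg_pow {i j : ℕ} (hij : i + j ≠ 0) :
    theta (-q ^ i) (-q ^ j) =
      qPochInf (q ^ i) (q ^ (i + j)) * qPochInf (q ^ j) (q ^ (i + j)) *
        qPochInf (q ^ (i + j)) (q ^ (i + j)) := by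
  rw [theta_eq_qPochInf, neg_mul_neg, neg_neg, neg_neg, ← pow_add]
  rw [neg_mul_neg, ← pow_add]
  exact dvd_pow hq hij

theorem theta_pow_pow_mul {i j : ℕ} (hij : i + j ≠ 0) :
    theta (q ^ i) (q ^ j) * (qPochInf (q ^ i) (q ^ (i + j)) * qPochInf (q ^ j) (q ^ (i + j))) =
      qPochInf ((q ^ 2) ^ i) ((q ^ 2) ^ (i + j)) * qPochInf ((q ^ 2) ^ j) ((q ^ 2) ^ (i + j)) *
        qPochInf (q ^ (i + j)) (q ^ (i + j)) := by
  have hX : X ∣ q ^ (i + j) := dvd_pow hq hij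
  simp only [pow_right_comm q 2, ← qPochInf_mul_qPochInf_neg _ hX]
  rw [theta_eq_qPochInf (by rwa [← pow_add]), ← pow_add]
  ring

theorem theta_neg_self_neg_pow_four :
    theta (-q) (-q ^ 4) = rrOne q * qPochInf (q ^ 5) (q ^ 5) := by
  simpa [rrOne] using theta_neg_pow_neg_pow hq (i := 1) (j := 4) (by simp)

theorem theta_neg_sq_neg_cube :
    theta (-q ^ 2) (-q ^ 3) = rrTwo q * qPochInf (q ^ 5) (q ^ 5) :=
  theta_neg_pow_neg_pow hq (by simp)

theorem theta_self_pow_four_mul :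
    theta q (q ^ 4) * rrOne q = rrOne (q ^ 2) * qPochInf (q ^ 5) (q ^ 5) := by
  simpa [rrOne] using theta_pow_pow_mul hq (i := 1) (j := 4) (by simp)

theorem theta_sq_cube_mul :
    theta (q ^ 2) (q ^ 3) * rrTwo q = rrTwo (q ^ 2) * qPochInf (q ^ 5) (q ^ 5) :=
  theta_pow_pow_mul hq (by simp)

theorem qPochInf_pow_eq_mul {i d : ℕ} (hd : d ≠ 0) :
    qPochInf (q ^ i) (q ^ d) =
      qPochInf (q ^ i) (q ^ (d * 2)) * qPochInf (q ^ (i + d)) (q ^ (d * 2)) := by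
  rw [qPochInf_eq_prod _ (dvd_pow hq hd) two_ne_zero]
  simp [Finset.prod_range_succ, ← pow_mul, ← pow_add]

theorem theta_neg_self_neg_pow_nine_mul :
    theta (-q) (-q ^ 9) * rrTwo (q ^ 2) = rrOne q * qPochInf (q ^ 10) (q ^ 10) := by
  have h := theta_neg_pow_neg_pow hq (i := 1) (j := 9) (by simp)
  have h₁ := qPochInf_pow_eq_mul hq (i := 1) (d := 5) (by simp)
  have h₄ := qPochInf_pow_eq_mul hq (i := 4) (d := 5) (by simp)
  simp only [pow_one, Nat.reduceAdd, Nat.reduceMul] at h h₁ h₄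
  simp only [rrOne, rrTwo, ← pow_mul, Nat.reduceMul, h, h₁, h₄]
  ring

theorem theta_neg_cube_neg_pow_seven_mul :
    theta (-q ^ 3) (-q ^ 7) * rrOne (q ^ 2) = rrTwo q * qPochInf (q ^ 10) (q ^ 10) := by
  have h := theta_neg_pow_neg_pow hq (i := 3) (j := 7) (by simp)
  have h₂ := qPochInf_pow_eq_mul hq (i := 2) (d := 5) (by simp)
  have h₃ := qPochInf_pow_eq_mul hq (i := 3) (d := 5) (by simp)
  simp only [Nat.reduceAdd, Nat.reduceMul] at h h₂ h₃
  simp only [rrOne, rrTwo, ← pow_mul, Nat.reduceMul, h, h₂, h₃]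
  ring

end RogersRamanujan

theorem rrOne_X_mul_rrTwo_X_mul_E_five : rrOne X * rrTwo X * E 5 = E 1 := by
  rw [E, E, pow_one, rrOne_mul_rrTwo_mul dvd_rfl]

theorem rrOne_X_sq_mul_rrTwo_X_sq_mul_E_ten : rrOne (X ^ 2) * rrTwo (X ^ 2) * E 10 = E 2 := by
  rw [E, E, ← rrOne_mul_rrTwo_mul (dvd_pow_self X two_ne_zero), ← pow_mul]

theorem theta_neg_X_sq_neg_X_pow_eight : theta (-X ^ 2) (-X ^ 8) = rrOne (X ^ 2) * E 10 := by
  simpa only [E, ← pow_mul] using theta_neg_self_neg_pow_four (dvd_pow_self X two_ne_zero)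

theorem theta_neg_X_pow_four_neg_X_pow_six :
    theta (-X ^ 4) (-X ^ 6) = rrTwo (X ^ 2) * E 10 := by
  simpa only [E, ← pow_mul] using theta_neg_sq_neg_cube (dvd_pow_self X two_ne_zero)

theorem E_five_sq_mul_eq_add :
    E 5 ^ 2 * (rrOne (X ^ 2) ^ 2 * rrTwo X * rrTwo (X ^ 2)) =
      E 10 ^ 2 * rrOne X * (rrTwo X * rrTwo (X ^ 2) ^ 2 + X * (rrOne X * rrOne (X ^ 2) ^ 2)) := by
  have h := theta_mul_theta_eq_add (a := X) (e := -X ^ 2) (g := -X) dvd_rfl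
  ring_nf at h
  rw [theta_comm (-X ^ 8), theta_comm (-X ^ 9), theta_neg_sq_neg_cube dvd_rfl, ← E,
    theta_neg_X_sq_neg_X_pow_eight, theta_neg_X_pow_four_neg_X_pow_six] at h
  have h₁ := theta_self_pow_four_mul (q := X) dvd_rfl
  have h₃ := theta_neg_cube_neg_pow_seven_mul (q := X) dvd_rfl
  have h₉ := theta_neg_self_neg_pow_nine_mul (q := X) dvd_rfl
  rw [← E] at h₁ h₃ h₉
  linear_combination rrOne X * rrOne (X ^ 2) * rrTwo (X ^ 2) * h -
    rrTwo X * E 5 * rrOne (X ^ 2) * rrTwo (X ^ 2) * h₁ +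
    rrOne X * rrTwo (X ^ 2) ^ 2 * E 10 * h₃ + X * rrOne X * rrOne (X ^ 2) ^ 2 * E 10 * h₉

theorem E_five_sq_mul_eq_sub :
    E 5 ^ 2 * (rrOne X * rrOne (X ^ 2) * rrTwo (X ^ 2) ^ 2) =
      E 10 ^ 2 * rrTwo X * (rrTwo X * rrTwo (X ^ 2) ^ 2 - X * (rrOne X * rrOne (X ^ 2) ^ 2)) := by
  have h := theta_mul_theta_eq_add (a := -X) (e := -X ^ 2) (g := -X) (by simp)
  ring_nf at h
  rw [theta_comm (-X ^ 8), theta_comm (-X ^ 9), theta_neg_self_neg_pow_four dvd_rfl, ← E,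
    theta_neg_X_sq_neg_X_pow_eight, theta_neg_X_pow_four_neg_X_pow_six] at h
  have h₂ := theta_sq_cube_mul (q := X) dvd_rfl
  have h₃ := theta_neg_cube_neg_pow_seven_mul (q := X) dvd_rfl
  have h₉ := theta_neg_self_neg_pow_nine_mul (q := X) dvd_rfl
  rw [← E] at h₂ h₃ h₉
  linear_combination rrTwo X * rrOne (X ^ 2) * rrTwo (X ^ 2) * h -
    rrOne X * E 5 * rrOne (X ^ 2) * rrTwo (X ^ 2) * h₂ +
    rrTwo X * rrTwo (X ^ 2) ^ 2 * E 10 * h₃ - X * rrTwo X * rrOne (X ^ 2) ^ 2 * E 10 * h₉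

theorem expand_psi_mul_E_five : expand 5 (by simp) psi * E 5 = E 10 ^ 2 := by
  have h := congrArg (expand 5 (by simp)) psi_mul_E_one
  rwa [map_mul, map_pow, expand_E two_ne_zero, expand_E one_ne_zero] at h

theorem expand_theta_neg_X_neg_X_mul_E_ten :
    expand 5 (by simp) (theta (-X) (-X)) * E 10 = E 5 ^ 2 := by
  have h := congrArg (expand 5 (by simp)) theta_neg_X_neg_X_mul_E_two
  rwa [map_mul, map_pow, expand_E two_ne_zero, expand_E one_ne_zero] at h

theorem two_mul_expand_psi : 2 * expand 5 (by simp) psi = theta 1 (X ^ 5) := by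
  have h := congrArg (expand 5 (by simp)) two_mul_psi
  rwa [map_mul, map_ofNat, expand_theta (by simp), map_one, expand_X] at h

theorem psi_sq :
    psi ^ 2 = X * expand 5 (by simp) psi ^ 2 + theta X (X ^ 4) * theta (X ^ 2) (X ^ 3) := by
  have h := theta_one_sq (a := X) dvd_rfl
  rw [← two_mul_psi, ← two_mul_expand_psi] at h
  refine mul_left_cancel₀ (OfNat.ofNat_ne_zero 4 : (4 : ℤ⟦X⟧) ≠ 0) ?_
  linear_combination h

theorem theta_mul_theta_mul_E_one_mul_E_ten :
    theta X (X ^ 4) * theta (X ^ 2) (X ^ 3) * (E 1 * E 10) = E 2 * E 5 ^ 3 := by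
  have h₁ := theta_self_pow_four_mul (q := X) dvd_rfl
  have h₂ := theta_sq_cube_mul (q := X) dvd_rfl
  rw [← E] at h₁ h₂
  rw [← rrOne_X_mul_rrTwo_X_mul_E_five, ← rrOne_X_sq_mul_rrTwo_X_sq_mul_E_ten]
  linear_combination theta (X ^ 2) (X ^ 3) * rrTwo X * E 5 * E 10 * h₁ +
    rrOne (X ^ 2) * E 5 ^ 2 * E 10 * h₂

theorem theta_neg_mul_theta_neg_mul_E_two_mul_E_five :
    theta (-X ^ 3) (-X ^ 7) * theta (-X) (-X ^ 9) * (E 2 * E 5) = E 1 * E 10 ^ 3 := by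
  have h₃ := theta_neg_cube_neg_pow_seven_mul (q := X) dvd_rfl
  have h₉ := theta_neg_self_neg_pow_nine_mul (q := X) dvd_rfl
  rw [← E] at h₃ h₉
  rw [← rrOne_X_mul_rrTwo_X_mul_E_five, ← rrOne_X_sq_mul_rrTwo_X_sq_mul_E_ten]
  linear_combination theta (-X) (-X ^ 9) * rrTwo (X ^ 2) * E 5 * E 10 * h₃ +
    rrTwo X * E 5 * E 10 ^ 2 * h₉

theorem E_two_pow_four_mul :
    E 2 ^ 4 * E 5 ^ 2 * E 10 = X * E 1 ^ 2 * E 10 ^ 5 + E 1 * E 2 * E 5 ^ 5 := by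
  have h := congrArg (E 1 ^ 2 * E 5 ^ 2 * E 10 * ·) psi_sq
  have h₁ := congrArg (· ^ 2) psi_mul_E_one
  have h₅ := congrArg (· ^ 2) expand_psi_mul_E_five
  linear_combination h - E 5 ^ 2 * E 10 * h₁ + X * E 1 ^ 2 * E 10 * h₅ +
    E 1 * E 5 ^ 2 * theta_mul_theta_mul_E_one_mul_E_ten

theorem theta_neg_X_neg_X_sq :
    theta (-X) (-X) ^ 2 = expand 5 (by simp) (theta (-X) (-X)) ^ 2 -
      4 * X * (theta (-X ^ 3) (-X ^ 7) * theta (-X) (-X ^ 9)) := by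
  have h := theta_self_sq (a := -X) (by simp)
  rw [expand_theta (by simp), map_neg, expand_X, h]
  ring_nf

theorem E_one_pow_four_mul :
    E 1 ^ 4 * E 5 * E 10 ^ 2 = E 2 ^ 2 * E 5 ^ 5 - 4 * X * E 1 * E 2 * E 10 ^ 5 := by
  have h := congrArg (E 2 ^ 2 * E 5 * E 10 ^ 2 * ·) theta_neg_X_neg_X_sq
  have h₂ := congrArg (· ^ 2) theta_neg_X_neg_X_mul_E_two
  have h₁₀ := congrArg (· ^ 2) expand_theta_neg_X_neg_X_mul_E_ten
  linear_combination h - E 5 * E 10 ^ 2 * h₂ + E 2 ^ 2 * E 5 * h₁₀ -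
    4 * X * E 2 * E 10 ^ 2 * theta_neg_mul_theta_neg_mul_E_two_mul_E_five

/-! ### Dissections modulo `5` -/

/-- The power series whose components modulo `5` are the `c i`. -/
noncomputable def assemble (c : Fin 5 → ℤ⟦X⟧) : ℤ⟦X⟧ :=
  ∑ i : Fin 5, expand 5 (by simp) (c i) * X ^ i.val

/-- The product of `∑ c i * t ^ i` and `∑ d i * t ^ i` in `R[t] / (t ^ 5 - x)`. It describes
products of power series in `t = q` through their components modulo `5`, where `x = q ^ 5`. -/
def quinticMul {R : Type*} [CommRing R] (x : R) (c d : Fin 5 → R) : Fin 5 → R :=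
  ![c 0 * d 0 + x * (c 1 * d 4 + c 2 * d 3 + c 3 * d 2 + c 4 * d 1),
    c 0 * d 1 + c 1 * d 0 + x * (c 2 * d 4 + c 3 * d 3 + c 4 * d 2),
    c 0 * d 2 + c 1 * d 1 + c 2 * d 0 + x * (c 3 * d 4 + c 4 * d 3),
    c 0 * d 3 + c 1 * d 2 + c 2 * d 1 + c 3 * d 0 + x * (c 4 * d 4),
    c 0 * d 4 + c 1 * d 3 + c 2 * d 2 + c 3 * d 1 + c 4 * d 0]

theorem assemble_mul (c d : Fin 5 → ℤ⟦X⟧) :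
    assemble c * assemble d = assemble (quinticMul X c d) := by
  simp only [assemble, quinticMul, Fin.sum_univ_five, Matrix.cons_val, map_add, map_mul, expand_X,
    Fin.coe_ofNat_eq_mod, Nat.reduceMod, pow_zero, pow_one, mul_one]
  ring

theorem sect_assemble (c : Fin 5 → ℤ⟦X⟧) (r : Fin 5) : sect 5 r (assemble c) = c r := by
  rw [assemble, map_sum, Finset.sum_eq_single r]
  · exact sect_expand_mul_X_pow_self (by simp) r.isLt _
  · exact fun i _ hi => sect_expand_mul_X_pow_of_ne (by simp) r.isLt
      (by rwa [Nat.mod_eq_of_lt i.isLt, Nat.mod_eq_of_lt r.isLt, Fin.val_ne_iff]) _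
  · simp

/-- The element `f - 2 a t + 2 b t ^ 4` of `R[t] / (t ^ 5 - x)`, in coordinates. -/
def quinticTheta {R : Type*} [CommRing R] (f a b : R) : Fin 5 → R :=
  ![f, -2 * a, 0, 0, 2 * b]

/-- The norm of `f - 2 a t + 2 b t ^ 4` from `R[t] / (t ^ 5 - x)` to `R`. -/
def quinticNorm {R : Type*} [CommRing R] (x f a b : R) : R :=
  f ^ 5 - 32 * x * a ^ 5 + 32 * x ^ 4 * b ^ 5 + 20 * x * f ^ 3 * a * b +
    80 * x ^ 2 * f * a ^ 2 * b ^ 2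

/-- The product of the four nontrivial conjugates of `f - 2 a t + 2 b t ^ 4` over `R`, where
`t ^ 5 = x`, in coordinates. -/
def quinticCofactor {R : Type*} [CommRing R] (x f a b : R) : Fin 5 → R :=
  ![f ^ 4 + 12 * x * f ^ 2 * a * b + 16 * x ^ 2 * a ^ 2 * b ^ 2,
    2 * f ^ 3 * a + 16 * x * f * a ^ 2 * b + 16 * x ^ 3 * b ^ 4,
    4 * f ^ 2 * a ^ 2 - 8 * x ^ 2 * f * b ^ 3 + 16 * x * a ^ 3 * b,
    4 * x * f ^ 2 * b ^ 2 + 8 * f * a ^ 3 + 16 * x ^ 2 * a * b ^ 3,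
    -2 * f ^ 3 * b - 16 * x * f * a * b ^ 2 + 16 * a ^ 4]

theorem quinticMul_quinticTheta_quinticCofactor {R : Type*} [CommRing R] (x f a b : R) :
    quinticMul x (quinticTheta f a b) (quinticCofactor x f a b) =
      ![quinticNorm x f a b, 0, 0, 0, 0] := by
  ext i
  fin_cases i <;> simp [quinticMul, quinticTheta, quinticCofactor, quinticNorm] <;> ring

theorem psi_eq_assemble :
    psi = assemble ![theta (X ^ 2) (X ^ 3), theta X (X ^ 4), 0, expand 5 (by simp) psi, 0] := by
  have h₀ : expand 5 (by simp) (theta (X ^ 2) (X ^ 3)) = theta (X ^ 10) (X ^ 15) := by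
    rw [expand_theta ((dvd_pow_self X two_ne_zero).mul_right _), map_pow, map_pow, expand_X,
      ← pow_mul, ← pow_mul]
  have h₁ : expand 5 (by simp) (theta X (X ^ 4)) = theta (X ^ 5) (X ^ 20) := by
    rw [expand_theta (Dvd.intro _ rfl), map_pow, expand_X, ← pow_mul]
  have h₃ : 2 * expand 5 (by simp) (expand 5 (by simp) psi) = theta 1 (X ^ 25) := by
    have h := congrArg (expand 5 (by simp)) two_mul_expand_psi
    rwa [map_mul, map_ofNat, expand_theta (by simp [pow_succ]), map_one, map_pow, expand_X,
      ← pow_mul] at h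
  refine mul_left_cancel₀ (two_ne_zero (α := ℤ⟦X⟧)) ?_
  rw [two_mul_psi, theta_one_five_dissection dvd_rfl, ← h₃]
  simp only [assemble, Fin.sum_univ_five, Matrix.cons_val, h₀, h₁, Fin.coe_ofNat_eq_mod,
    Nat.reduceMod, pow_zero, pow_one, map_zero]
  ring

theorem theta_neg_X_neg_X_eq_assemble :
    theta (-X) (-X) = assemble (quinticTheta (expand 5 (by simp) (theta (-X) (-X)))
      (theta (-X ^ 3) (-X ^ 7)) (theta (-X) (-X ^ 9))) := by
  have h₀ : expand 5 (by simp) (expand 5 (by simp) (theta (-X) (-X))) =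
      theta (-X ^ 25) (-X ^ 25) := by
    rw [expand_theta (by simp), map_neg, expand_X, expand_theta
      ((dvd_pow_self X (by simp)).neg_right.mul_right _), map_neg, map_pow, expand_X, ← pow_mul]
  have h₁ : expand 5 (by simp) (theta (-X ^ 3) (-X ^ 7)) = theta (-X ^ 15) (-X ^ 35) := by
    rw [expand_theta ((dvd_pow_self X three_ne_zero).neg_right.mul_right _), map_neg, map_neg,
      map_pow, map_pow, expand_X, ← pow_mul, ← pow_mul]
  have h₄ : expand 5 (by simp) (theta (-X) (-X ^ 9)) = theta (-X ^ 5) (-X ^ 45) := by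
    rw [expand_theta (by simp), map_neg, map_neg, map_pow, expand_X, ← pow_mul]
  rw [assemble, Fin.sum_univ_five]
  simp only [quinticTheta, Matrix.cons_val, map_mul, map_neg, map_ofNat, map_zero, h₀, h₁, h₄]
  conv_lhs => rw [theta_self_five_dissection (a := -X) (by simp)]
  simp only [Fin.coe_ofNat_eq_mod, Nat.reduceMod]
  ring_nf

/-- The coefficient of `t ^ 4` in `(A + B t + P t ^ 3) ^ 3 / (f - 2 a t + 2 b t ^ 4) ^ 2`, where
`t ^ 5 = x`, multiplied by the square of the norm of the denominator. -/
def cofactorComponent {R : Type*} [CommRing R] (x f a b A B P : R) : R :=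
  quinticMul x (quinticMul x ![A, B, 0, P, 0] (quinticMul x ![A, B, 0, P, 0] ![A, B, 0, P, 0]))
    (quinticMul x (quinticCofactor x f a b) (quinticCofactor x f a b)) 4

theorem quinticNorm_sq_mul_sect :
    quinticNorm X (expand 5 (by simp) (theta (-X) (-X))) (theta (-X ^ 3) (-X ^ 7))
        (theta (-X) (-X ^ 9)) ^ 2 * sect 5 4 (sect 2 1 phi) =
      cofactorComponent X (expand 5 (by simp) (theta (-X) (-X))) (theta (-X ^ 3) (-X ^ 7))
        (theta (-X) (-X ^ 9)) (theta (X ^ 2) (X ^ 3)) (theta X (X ^ 4))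
        (expand 5 (by simp) psi) := by
  have hf := theta_neg_X_neg_X_eq_assemble
  set f := expand 5 (by simp) (theta (-X) (-X))
  set a := theta (-X ^ 3 : ℤ⟦X⟧) (-X ^ 7)
  set b := theta (-X : ℤ⟦X⟧) (-X ^ 9)
  have hN : expand 5 (by simp) (quinticNorm X f a b) =
      theta (-X) (-X) * assemble (quinticCofactor X f a b) := by
    rw [hf, assemble_mul, quinticMul_quinticTheta_quinticCofactor]
    simp [assemble, Fin.sum_univ_five]
  refine .trans ?_ (sect_assemble _ 4)
  rw [← sect_expand_mul (by simp) (by simp), map_pow, hN]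
  simp only [← assemble_mul, ← psi_eq_assemble]
  refine congrArg (sect 5 4) ?_
  linear_combination assemble (quinticCofactor X f a b) ^ 2 * sect_two_one_phi_mul_theta_sq

/-! ### Ramanujan's parametrisation -/

theorem map_quinticNorm {R S : Type*} [CommRing R] [CommRing S] (φ : R →+* S) (x f a b : R) :
    φ (quinticNorm x f a b) = quinticNorm (φ x) (φ f) (φ a) (φ b) := by
  simp only [quinticNorm, map_add, map_sub, map_mul, map_pow, map_ofNat]

theorem map_cofactorComponent {R S : Type*} [CommRing R] [CommRing S] (φ : R →+* S)
    (x f a b A B P : R) : φ (cofactorComponent x f a b A B P) =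
      cofactorComponent (φ x) (φ f) (φ a) (φ b) (φ A) (φ B) (φ P) := by
  simp only [cofactorComponent, quinticMul, quinticCofactor, Matrix.cons_val, map_add, map_sub,
    map_neg, map_mul, map_pow, map_ofNat, map_zero]

section Field

variable {K : Type*} [Field K]

theorem quinticNorm_scale (x f b α : K) :
    quinticNorm x f (f * α) (f * (b * α ^ 4)) = f ^ 5 * quinticNorm (x * α ^ 5) 1 1 b := by
  simp only [quinticNorm]
  ring

theorem cofactorComponent_scale (x f b A B P : K) {α : K} (hα : α ≠ 0) :
    cofactorComponent x f (f * α) (f * (b * α ^ 4)) (P * (A / α ^ 3)) (P * (B / α ^ 2)) P =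
      f ^ 8 * P ^ 3 / α ^ 5 * cofactorComponent (x * α ^ 5) 1 1 b A B 1 := by
  simp only [cofactorComponent, quinticMul, quinticCofactor, Matrix.cons_val]
  field_simp
  ring

variable {k T : K} (hk : k ≠ 0) (hu : 1 + k ≠ 0) (hv : 1 - k ≠ 0) (hT : T * k = (1 + k) * (1 - k))
include hk hu hv hT

theorem quinticNorm_param :
    quinticNorm (k / ((1 + k) ^ 2 * (1 - k) ^ 3)) 1 1 ((1 + k) * (1 - k) ^ 2) =
      ((T - 4) / T) ^ 3 := by
  rw [eq_div_of_mul_eq hk hT, quinticNorm]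
  field_simp
  ring

theorem cofactorComponent_param (hT₁ : T + 1 ≠ 0) :
    cofactorComponent (k / ((1 + k) ^ 2 * (1 - k) ^ 3)) 1 1 ((1 + k) * (1 - k) ^ 2)
        (1 / ((1 + k) * (1 - k))) (1 / (1 - k)) 1 =
      5 * (k / ((1 + k) ^ 2 * (1 - k) ^ 3)) *
        (46 * (T - 4) ^ 6 + 460 * (T - 4) ^ 5 + 1125 * (T - 4) ^ 4 +
          1875 * T ^ 2 * (T + 1) * (T - 4) ^ 2 + 15625 * T ^ 4) / ((T + 1) * T ^ 4) := by
  have hT' := eq_div_of_mul_eq hk hT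
  have hw : (1 + k) * (1 - k) + k ≠ 0 := by
    rw [← hT, ← add_one_mul]
    exact mul_ne_zero hT₁ hk
  have hT₁' : T + 1 = ((1 + k) * (1 - k) + k) / k := by rw [hT', div_add_one hk]
  rw [hT₁', hT']
  simp only [cofactorComponent, quinticMul, quinticCofactor, Matrix.cons_val]
  field_simp
  ring

end Field

section Parametrisation

variable {K : Type*} [Field K] (ι : ℤ⟦X⟧ →+* K)

/-- Ramanujan's parameter `k = r(q) r(q ^ 2) ^ 2`, where `r` is the Rogers–Ramanujan continued
fraction, as an element of a field containing `ℤ⟦X⟧`. -/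
noncomputable def ramanujanParam : K :=
  ι (X * rrOne X * rrOne (X ^ 2) ^ 2) / ι (rrTwo X * rrTwo (X ^ 2) ^ 2)

/-- The ratio of the components of degrees `1` and `0` of `θ(-q, -q)` modulo `5`, up to the factor
`-2`. Dividing `q` by it makes the components of `θ(-q, -q)` and `psi` polynomial or inverse
polynomial in `1 ± k`. -/
noncomputable def thetaScale : K :=
  ι (E 10 ^ 2 * rrTwo X) / ι (E 5 ^ 2 * rrOne (X ^ 2))

/-- The Hauptmodul of `Γ₀(10)` through which the final identity is expressed. -/
noncomputable def hauptmodul : K := ι (E 2 * E 5 ^ 5) / ι (X * E 1 * E 10 ^ 5)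

@[simp]
theorem map_E_ne_zero {j : ℕ} (hj : 0 < j) : ι (E j) ≠ 0 := ((isUnit_E hj).map ι).ne_zero

@[simp]
theorem map_rrOne_ne_zero {q : ℤ⟦X⟧} (hq : X ∣ q) : ι (rrOne q) ≠ 0 :=
  ((isUnit_rrOne hq).map ι).ne_zero

@[simp]
theorem map_rrTwo_ne_zero {q : ℤ⟦X⟧} (hq : X ∣ q) : ι (rrTwo q) ≠ 0 :=
  ((isUnit_rrTwo hq).map ι).ne_zero

theorem one_add_ramanujanParam :
    1 + ramanujanParam ι =
      ι (E 5 ^ 2 * rrOne (X ^ 2) ^ 2) / ι (E 10 ^ 2 * rrOne X * rrTwo (X ^ 2)) := by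
  have h := congrArg ι E_five_sq_mul_eq_add
  simp only [ramanujanParam, map_mul, map_pow, map_add] at h ⊢
  field_simp (disch := simp)
  linear_combination -h

theorem one_sub_ramanujanParam :
    1 - ramanujanParam ι = ι (E 5 ^ 2 * rrOne X * rrOne (X ^ 2)) / ι (E 10 ^ 2 * rrTwo X ^ 2) := by
  have h := congrArg ι E_five_sq_mul_eq_sub
  simp only [ramanujanParam, map_mul, map_pow, map_sub] at h ⊢
  field_simp (disch := simp)
  linear_combination -h

theorem one_add_ramanujanParam_ne_zero : 1 + ramanujanParam ι ≠ 0 := by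
  rw [one_add_ramanujanParam]
  simp

theorem one_sub_ramanujanParam_ne_zero : 1 - ramanujanParam ι ≠ 0 := by
  rw [one_sub_ramanujanParam]
  simp

theorem thetaScale_ne_zero : thetaScale ι ≠ 0 := by
  simp [thetaScale]

theorem map_X_mul_thetaScale_pow_five :
    ι X * thetaScale ι ^ 5 =
      ramanujanParam ι / ((1 + ramanujanParam ι) ^ 2 * (1 - ramanujanParam ι) ^ 3) := by
  rw [one_add_ramanujanParam, one_sub_ramanujanParam, ramanujanParam, thetaScale]
  simp only [map_mul, map_pow]
  field_simp (disch := simp)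

theorem map_expand_psi : ι (expand 5 (by simp) psi) = ι (E 10 ^ 2) / ι (E 5) :=
  eq_div_of_mul_eq (map_E_ne_zero ι (by simp)) (by rw [← map_mul, expand_psi_mul_E_five])

theorem map_expand_theta :
    ι (expand 5 (by simp) (theta (-X) (-X))) = ι (E 5 ^ 2) / ι (E 10) :=
  eq_div_of_mul_eq (map_E_ne_zero ι (by simp))
    (by rw [← map_mul, expand_theta_neg_X_neg_X_mul_E_ten])

theorem map_theta_neg_X_pow_three :
    ι (theta (-X ^ 3) (-X ^ 7)) = ι (expand 5 (by simp) (theta (-X) (-X))) * thetaScale ι := by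
  have h := congrArg ι (theta_neg_cube_neg_pow_seven_mul (q := X) dvd_rfl)
  rw [map_expand_theta, thetaScale]
  rw [← E] at h
  simp only [map_mul, map_pow] at h ⊢
  field_simp (disch := simp)
  linear_combination h

theorem map_theta_neg_X :
    ι (theta (-X) (-X ^ 9)) = ι (expand 5 (by simp) (theta (-X) (-X))) *
      ((1 + ramanujanParam ι) * (1 - ramanujanParam ι) ^ 2 * thetaScale ι ^ 4) := by
  have h := congrArg ι (theta_neg_self_neg_pow_nine_mul (q := X) dvd_rfl)
  rw [map_expand_theta, one_add_ramanujanParam, one_sub_ramanujanParam, thetaScale]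
  rw [← E] at h
  simp only [map_mul, map_pow] at h ⊢
  field_simp (disch := simp)
  linear_combination h

theorem map_theta_X_sq :
    ι (theta (X ^ 2) (X ^ 3)) = ι (expand 5 (by simp) psi) *
      (1 / ((1 + ramanujanParam ι) * (1 - ramanujanParam ι)) / thetaScale ι ^ 3) := by
  have h := congrArg ι (theta_sq_cube_mul (q := X) dvd_rfl)
  rw [map_expand_psi, one_add_ramanujanParam, one_sub_ramanujanParam, thetaScale]
  rw [← E] at h
  simp only [map_mul, map_pow] at h ⊢
  field_simp (disch := simp)
  linear_combination h

theorem map_theta_X :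
    ι (theta X (X ^ 4)) = ι (expand 5 (by simp) psi) *
      (1 / (1 - ramanujanParam ι) / thetaScale ι ^ 2) := by
  have h := congrArg ι (theta_self_pow_four_mul (q := X) dvd_rfl)
  rw [map_expand_psi, one_sub_ramanujanParam, thetaScale]
  rw [← E] at h
  simp only [map_mul, map_pow] at h ⊢
  field_simp (disch := simp)
  linear_combination h

variable {ι} (hι : Function.Injective ι)
include hι

theorem ramanujanParam_ne_zero : ramanujanParam ι ≠ 0 := by
  simp [ramanujanParam, map_X_ne_zero hι]

theorem hauptmodul_mul_ramanujanParam :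
    hauptmodul ι * ramanujanParam ι = (1 + ramanujanParam ι) * (1 - ramanujanParam ι) := by
  rw [one_add_ramanujanParam, one_sub_ramanujanParam, ramanujanParam, hauptmodul,
    ← rrOne_X_mul_rrTwo_X_mul_E_five, ← rrOne_X_sq_mul_rrTwo_X_sq_mul_E_ten]
  simp only [map_mul, map_pow]
  field_simp (disch := simp [map_X_ne_zero hι])

theorem hauptmodul_add_one :
    hauptmodul ι + 1 = ι (E 2 ^ 4 * E 5 ^ 2) / ι (X * E 1 ^ 2 * E 10 ^ 4) := by
  have h := congrArg ι E_two_pow_four_mul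
  simp only [hauptmodul, map_mul, map_pow, map_add] at h ⊢
  field_simp (disch := simp [map_X_ne_zero hι])
  linear_combination -h

theorem hauptmodul_sub_four :
    hauptmodul ι - 4 = ι (E 1 ^ 3 * E 5) / ι (X * E 2 * E 10 ^ 3) := by
  have h := congrArg ι E_one_pow_four_mul
  simp only [hauptmodul, map_mul, map_pow, map_sub, map_ofNat] at h ⊢
  field_simp (disch := simp [map_X_ne_zero hι])
  linear_combination -h

theorem hauptmodul_ne_zero : hauptmodul ι ≠ 0 := by
  simp [hauptmodul, map_X_ne_zero hι]

theorem hauptmodul_add_one_ne_zero : hauptmodul ι + 1 ≠ 0 := by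
  simp [hauptmodul_add_one hι, map_X_ne_zero hι]

theorem map_sect_mul_hauptmodul :
    ι (sect 5 4 (sect 2 1 phi)) * ι (expand 5 (by simp) (theta (-X) (-X))) ^ 2 *
        ((hauptmodul ι + 1) * (hauptmodul ι - 4) ^ 6) =
      5 * ι X * ι (expand 5 (by simp) psi) ^ 3 * hauptmodul ι ^ 2 *
        (46 * (hauptmodul ι - 4) ^ 6 + 460 * (hauptmodul ι - 4) ^ 5 +
          1125 * (hauptmodul ι - 4) ^ 4 +
          1875 * hauptmodul ι ^ 2 * (hauptmodul ι + 1) * (hauptmodul ι - 4) ^ 2 +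
          15625 * hauptmodul ι ^ 4) := by
  have hs := congrArg ι quinticNorm_sq_mul_sect
  have hf : ι (expand 5 (by simp) (theta (-X) (-X))) ≠ 0 := by
    simp [map_expand_theta]
  have hα := thetaScale_ne_zero ι
  have hT := hauptmodul_ne_zero hι
  have hT₁ := hauptmodul_add_one_ne_zero hι
  have hk := ramanujanParam_ne_zero hι
  have hu := one_add_ramanujanParam_ne_zero ι
  have hv := one_sub_ramanujanParam_ne_zero ι
  have hkT := hauptmodul_mul_ramanujanParam hι
  rw [map_mul, map_pow, map_quinticNorm, map_cofactorComponent, map_theta_neg_X_pow_three,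
    map_theta_neg_X, map_theta_X_sq, map_theta_X, quinticNorm_scale,
    cofactorComponent_scale _ _ _ _ _ _ hα,
    map_X_mul_thetaScale_pow_five, quinticNorm_param hk hu hv hkT,
    cofactorComponent_param hk hu hv hkT hT₁, ← map_X_mul_thetaScale_pow_five] at hs
  field_simp at hs
  linear_combination hs

end Parametrisation

theorem sect_five_four_sect_two_one_phi :
    sect 5 4 (sect 2 1 phi) =
      5 * (46 * quot (E 5 * E 10 ^ 2) (E 2 ^ 2)
        + 460 * X * quot (E 10 ^ 5) (E 1 ^ 3 * E 2)
        + 1125 * X ^ 2 * quot (E 10 ^ 8) (E 1 ^ 6 * E 5)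
        + 1875 * X * quot (E 2 ^ 8 * E 5 ^ 9) (E 1 ^ 16)
        + 15625 * X ^ 2 * quot (E 2 ^ 8 * E 5 ^ 15) (E 1 ^ 22)) := by
  have u₁ := isUnit_E one_pos
  have u₂ := isUnit_E two_pos
  have u₅ := isUnit_E (j := 5) (by simp)
  have hι := IsFractionRing.injective ℤ⟦X⟧ (FractionRing ℤ⟦X⟧)
  set ι := algebraMap ℤ⟦X⟧ (FractionRing ℤ⟦X⟧)
  have hX := map_X_ne_zero hι
  have h₁ := map_E_ne_zero ι one_pos
  have h₂ := map_E_ne_zero ι two_pos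
  have h₅ := map_E_ne_zero ι (j := 5) (by simp)
  have h₁₀ := map_E_ne_zero ι (j := 10) (by simp)
  have hs := map_sect_mul_hauptmodul hι
  rw [hauptmodul_add_one hι, hauptmodul_sub_four hι, hauptmodul, map_expand_psi,
    map_expand_theta] at hs
  apply hι
  simp only [map_mul, map_add, map_pow, map_ofNat, map_quot ι _ (u₂.pow 2),
    map_quot ι _ ((u₁.pow 3).mul u₂), map_quot ι _ ((u₁.pow 6).mul u₅),
    map_quot ι _ (u₁.pow 16), map_quot ι _ (u₁.pow 22)] at hs ⊢
  field_simp at hs ⊢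
  linear_combination hs

end AppellLerch

theorem theorem3p1 :
    PowerSeries.mk (fun n : ℕ => AppellLerch.a (10 * n + 9)) =
        5 * (46 * AppellLerch.quot (AppellLerch.E 5 * AppellLerch.E 10 ^ 2) (AppellLerch.E 2 ^ 2)
          + 460 * X * AppellLerch.quot (AppellLerch.E 10 ^ 5)
              (AppellLerch.E 1 ^ 3 * AppellLerch.E 2)
          + 1125 * X ^ 2 * AppellLerch.quot (AppellLerch.E 10 ^ 8)
              (AppellLerch.E 1 ^ 6 * AppellLerch.E 5)
          + 1875 * X * AppellLerch.quot (AppellLerch.E 2 ^ 8 * AppellLerch.E 5 ^ 9)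
              (AppellLerch.E 1 ^ 16)
          + 15625 * X ^ 2 * AppellLerch.quot (AppellLerch.E 2 ^ 8 * AppellLerch.E 5 ^ 15)
              (AppellLerch.E 1 ^ 22))
      ∧ ∀ n : ℕ, AppellLerch.a (10 * n + 9) ≡ 0 [ZMOD 5] := by
  have ha (n : ℕ) : coeff n (AppellLerch.sect 5 4 (AppellLerch.sect 2 1 AppellLerch.phi)) =
      AppellLerch.a (10 * n + 9) := by
    rw [AppellLerch.coeff_sect, AppellLerch.coeff_sect, AppellLerch.a]
    congr 2
    ring
  rw [AppellLerch.sect_five_four_sect_two_one_phi] at ha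
  refine ⟨PowerSeries.ext fun n => by rw [coeff_mk, ha], fun n => ?_⟩
  rw [← ha, Int.modEq_zero_iff_dvd, ← map_ofNat (C (R := ℤ)) 5, coeff_C_mul]
  exact dvd_mul_right _ _
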